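/- Theorem. Let $T>0$, $p\in(2,3)$, $q\ge p$ with $2/p+1/q>1$, and define $r$ by $1/r=1/p+1/q$. Write $X_{s,t}:=X_t-X_s$ for increments of a path and $\Delta_{[0,T]}:=\{(s,t):0\le s\le t\le T\}$; let $\otimes$ be the tensor product $(a\otimes b)^{ij}=a^ib^j$, and for a two-parameter function $R$ and $\rho\geq 1$ say that $R$ has finite $\rho$-variation if $\sup_{\mathcal P}\sum_{[s,t]\in\mathcal P}|R_{s,t}|^{\rho}<\infty$, the supremum being over all finite partitions of $[0,T]$ (for a path, take its increments). Property (RIE). Let $\mathcal P^n=\{0=t^n_0<\dots<t^n_{N_n}=T\}$, $n\in\mathbb N$, be partitions of $[0,T]$ with mesh size tending to $0$. A continuous path $S:[0,T]\to\mathbb R^d$ satisfies (RIE) with respect to $p$ and $(\mathcal P^n)_{n\in\mathbb N}$ if the Riemann sums $$\int_0^t S^n_u\otimes dS_u:=\sum_{k=0}^{N_n-1}S_{t^n_k}\otimes S_{t^n_k\wedge t,\,t^n_{k+1}\wedge t}$$ converge as $n\to\infty$, uniformly in $t\in[0,T]$, to a limit denoted $\int_0^tS_u\otimes dS_u$, and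 there is a superadditive function $c:\Delta_{[0,T]}\to[0,\infty)$ (that is, $c(s,u)+c(u,t)\le c(s,t)$ for $0\le s\le u\le t\le T$) such that, with $0/0:=0$ and $x/0:=\infty$ for $x>0$, $$\sup_{(s,t)\in\Delta_{[0,T]}}\frac{|S_{s,t}|^p}{c(s,t)}+\sup_{n\in\mathbb N}\ \sup_{0\le k<\ell\le N_n}\frac{\big|\int_{t^n_k}^{t^n_\ell}S^n_u\otimes dS_u-S_{t^n_k}\otimes S_{t^n_k,t^n_\ell}\big|^{p/2}}{c(t^n_k,t^n_\ell)}\le1 .$$ In this case set $\mathbb S_{s,t}:=\int_s^tS_u\otimes dS_u-S_s\otimes S_{s,t}$ for $(s,t)\in\Delta_{[0,T]}$. Controlled paths. For $m\in\mathbb N$, $\mathcal V^q_S([0,T];\mathbb R^m)$ is the set of pairs $(F,F')$ of continuous maps $F:[0,T]\to\mathbb R^m$, $F':[0,T]\to\mathcal L(\mathbb R^d;\mathbb R^m)$ such that $F'$ has finite $q$-variation and the remainder $R^F_{s,t}:=F_{s,t}-F'_sS_{s,t}$ has finite $r$-variation. Assume that $S$ satisfies (RIE) with respect to $p$ and $(\mathcal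 P^n)_{n\in\mathbb N}$. Let $A\subseteq\mathbb R^d$ be open with $S_t\in A$ for all $t\in[0,T]$, let $\epsilon>0$, and let $f:A\to\mathbb R^m$ be of class $C^{p+\epsilon}$, i.e., writing $p+\epsilon=k+\gamma$ with $k\in\mathbb N$ and $\gamma\in(0,1]$, $f$ is $k$ times continuously differentiable on $A$ and $\mathrm D^kf$ is locally $\gamma$-Hölder continuous on $A$. Then $(f(S),\mathrm Df(S))\in\mathcal V^q_S([0,T];\mathbb R^m)$, and for every $(Y,Y')\in\mathcal V^q_S([0,T];\mathbb R^m)$: 1. For every $t\in[0,T]$ the integral of $(Y,Y')$ against $(f(S),\mathrm Df(S))$, $$\int_0^tY_u\,df(S)_u:=\lim_{|\mathcal P|\to0}\sum_{[s,u]\in\mathcal P}\Big(Y_s\cdot f(S)_{s,u}+Y'_s\,\mathrm Df(S_s)\,\mathbb S_{s,u}\Big),$$ exists, the limit being over partitions $\mathcal P$ of $[0,t]$ with mesh size $|\mathcal P|$ tending to $0$, where $a\cdot b$ is the Euclidean inner product and $BCM:=\sum_{i=1}^m\sum_{j,l=1}^dB^{ij}C^{il}M^{jl}$ for $B,C\in\mathcal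 L(\mathbb R^d;\mathbb R^m)$ and $M\in\mathbb R^{d\times d}$. 2. $$\int_0^tY_u\,df(S)_u=\lim_{n\to\infty}\sum_{k=0}^{N_n-1}Y_{t^n_k}\cdot f(S)_{t^n_k\wedge t,\,t^n_{k+1}\wedge t},$$ and the convergence is uniform in $t\in[0,T]$. -/

import Mathlib

open Filter Topology Set
open scoped NNReal ENNReal

noncomputable section

namespace RoughRIE

/-- Euclidean space of dimension `d`. -/
abbrev Vec (d : ℕ) : Type := EuclideanSpace ℝ (Fin d)

/-- Real `d × d` matrices with the Euclidean (Frobenius) norm. -/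
abbrev Mat (d : ℕ) : Type := EuclideanSpace ℝ (Fin d × Fin d)

/-- The tensor product of two vectors: `(a ⊗ b) (i, j) = a i * b j`. -/
def tensor {d : ℕ} (a b : Vec d) : Mat d :=
  WithLp.toLp 2 fun ij => a ij.1 * b ij.2

/-- A finite partition `a = t 0 < t 1 < ⋯ < t N = b` of the interval `[a, b]`
(values `t k` with `k > N` play no role). -/
structure IntervalPartition (a b : ℝ) where
  N : ℕ
  t : ℕ → ℝ
  strictMono : StrictMonoOn t (Set.Iic N)
  left : t 0 = a
  right : t N = b

/-- The mesh size `max {|t (k+1) - t k| : k < N}` (equal to `0` if `N = 0`). -/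
def IntervalPartition.mesh {a b : ℝ} (P : IntervalPartition a b) : ℝ :=
  ⨆ k : Fin P.N, |P.t (k + 1) - P.t k|

/-- The filter "mesh size tends to `0`" on the partitions of `[a, b]`. -/
def meshFilter (a b : ℝ) : Filter (IntervalPartition a b) :=
  comap IntervalPartition.mesh (𝓝 0)

/-- The `p`-variation over `[a, b]` of a two-parameter function `R`. -/
def pVar {E : Type*} [NormedAddCommGroup E] (p : ℝ) (R : ℝ → ℝ → E) (a b : ℝ) : ℝ≥0∞ :=
  ⨆ P : IntervalPartition a b,
    (∑ k ∈ Finset.range P.N, ‖R (P.t k) (P.t (k + 1))‖ₑ ^ p) ^ (1 / p)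

/-- The increments `X_{s,t} = X_t - X_s` of a path. -/
def incr {E : Type*} [AddGroup E] (X : ℝ → E) (s t : ℝ) : E := X t - X s

/-- Control functions on `{(s, t) : 0 ≤ s ≤ t ≤ T}`: nonnegative and superadditive. -/
def IsControl (T : ℝ) (c : ℝ → ℝ → ℝ≥0) : Prop :=
  ∀ s u t : ℝ, 0 ≤ s → s ≤ u → u ≤ t → t ≤ T → c s u + c u t ≤ c s t

/-- The left-point Riemann sum `∑ k, S_{t_k} ⊗ S_{t_k ∧ t, t_{k+1} ∧ t}` along a partition. -/
def tensorSum {d : ℕ} {T : ℝ} (S : ℝ → Vec d) (P : IntervalPartition 0 T) (t : ℝ) : Mat d :=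
  ∑ k ∈ Finset.range P.N, tensor (S (P.t k)) (incr S (min (P.t k) t) (min (P.t (k + 1)) t))

/-- Property (RIE) for the path `S` on `[0, T]`, with respect to `p` and the sequence of
partitions `P`. The quotients are formed in `[0, ∞]`, where `0 / 0 = 0` and `x / 0 = ∞`
for `x > 0`. -/
structure SatisfiesRIE {d : ℕ} (T p : ℝ) (P : ℕ → IntervalPartition 0 T) (S : ℝ → Vec d) :
    Prop where
  two_lt : 2 < p
  lt_three : p < 3
  mesh_tendsto : Tendsto (fun n => (P n).mesh) atTop (𝓝 0)
  continuousOn : ContinuousOn S (Icc 0 T)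
  converges : ∃ J : ℝ → Mat d,
    TendstoUniformlyOn (fun n t => tensorSum S (P n) t) J atTop (Icc 0 T)
  control : ∃ c : ℝ → ℝ → ℝ≥0, IsControl T c ∧
    (⨆ (s : ℝ) (t : ℝ) (_ : 0 ≤ s ∧ s ≤ t ∧ t ≤ T), ‖incr S s t‖ₑ ^ p / (c s t : ℝ≥0∞)) +
    (⨆ (n : ℕ) (k : ℕ) (l : ℕ) (_ : k < l ∧ l ≤ (P n).N),
      ‖tensorSum S (P n) ((P n).t l) - tensorSum S (P n) ((P n).t k) -
          tensor (S ((P n).t k)) (incr S ((P n).t k) ((P n).t l))‖ₑ ^ (p / 2) /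
        (c ((P n).t k) ((P n).t l) : ℝ≥0∞)) ≤ 1

/-- The limit `∫_0^t S_u ⊗ dS_u` of the left-point Riemann sums along `P`
(it exists, uniformly in `t`, under (RIE)). -/
def limitIntegral {d : ℕ} {T : ℝ} (P : ℕ → IntervalPartition 0 T) (S : ℝ → Vec d) (t : ℝ) :
    Mat d :=
  limUnder atTop fun n => tensorSum S (P n) t

/-- The second level `𝕊_{s,t} = ∫_s^t S_u ⊗ dS_u - S_s ⊗ S_{s,t}` of the rough path
associated with a path satisfying (RIE). -/
def area {d : ℕ} {T : ℝ} (P : ℕ → IntervalPartition 0 T) (S : ℝ → Vec d) (s t : ℝ) : Mat d :=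
  limitIntegral P S t - limitIntegral P S s - tensor (S s) (incr S s t)

/-- The remainder `R_{s,t} = F_{s,t} - F'_s S_{s,t}`. -/
def remainder {d m : ℕ} (S : ℝ → Vec d) (F : ℝ → Vec m) (F' : ℝ → Vec d →L[ℝ] Vec m)
    (s t : ℝ) : Vec m :=
  incr F s t - F' s (incr S s t)

/-- `(F, F')` is an `S`-controlled path on `[0, T]`, i.e. `(F, F') ∈ 𝓥^q_S`: the paths `F`, `F'`
are continuous, `F'` has finite `q`-variation and the remainder has finite `r`-variation, where
`1 / r = 1 / p + 1 / q`. -/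
structure IsControlledPath {d m : ℕ} (T p q : ℝ) (S : ℝ → Vec d) (F : ℝ → Vec m)
    (F' : ℝ → Vec d →L[ℝ] Vec m) : Prop where
  continuousOn : ContinuousOn F (Icc 0 T)
  continuousOn_deriv : ContinuousOn F' (Icc 0 T)
  deriv_var : pVar q (incr F') 0 T < ∞
  remainder_var : pVar (1 / (1 / p + 1 / q)) (remainder S F F') 0 T < ∞

/-- The product `A B M = ∑ i j l, A_{ij} B_{il} M_{jl}` of two linear maps and a matrix, where
`A_{ij}` is the `i`-th coordinate of the image of the `j`-th standard basis vector. -/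
def contract {d m : ℕ} (A B : Vec d →L[ℝ] Vec m) (M : Mat d) : ℝ :=
  ∑ i, ∑ j, ∑ l, A (EuclideanSpace.single j 1) i * B (EuclideanSpace.single l 1) i * M (j, l)

/-- The compensated Riemann sum `∑_{[s,u] ∈ Q} F_s G_{s,u} + F'_s G'_s 𝕊_{s,u}`, where `F_s G_{s,u}`
is the Euclidean inner product. -/
def compensatedSum {d m : ℕ} (SS : ℝ → ℝ → Mat d) (F : ℝ → Vec m) (F' : ℝ → Vec d →L[ℝ] Vec m)
    (G : ℝ → Vec m) (G' : ℝ → Vec d →L[ℝ] Vec m) {a b : ℝ} (Q : IntervalPartition a b) : ℝ :=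
  ∑ k ∈ Finset.range Q.N,
    (inner ℝ (F (Q.t k)) (incr G (Q.t k) (Q.t (k + 1))) +
      contract (F' (Q.t k)) (G' (Q.t k)) (SS (Q.t k) (Q.t (k + 1))))

/-- The integral `∫_0^t F_u dG_u` of `(F, F')` against `(G, G')` with respect to the rough path
with second level `SS`: the limit of compensated Riemann sums as the mesh size tends to `0`. -/
def controlledIntegral {d m : ℕ} (SS : ℝ → ℝ → Mat d) (F : ℝ → Vec m)
    (F' : ℝ → Vec d →L[ℝ] Vec m) (G : ℝ → Vec m) (G' : ℝ → Vec d →L[ℝ] Vec m) (t : ℝ) : ℝ :=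
  limUnder (meshFilter 0 t) fun Q => compensatedSum SS F F' G G' Q

/-- `f ∈ C^β(A)` for an open set `A` and real `β > 0`: writing `β = k + γ` with `k ∈ ℕ` and
`γ ∈ (0, 1]`, the function `f` is `k` times continuously differentiable on `A` and its `k`-th
derivative is locally `γ`-Hölder continuous on `A`. -/
def IsCHolder {d m : ℕ} (β : ℝ) (f : Vec d → Vec m) (A : Set (Vec d)) : Prop :=
  ∃ (k : ℕ) (γ : ℝ≥0), 0 < γ ∧ γ ≤ 1 ∧ β = k + γ ∧ ContDiffOn ℝ k f A ∧
    ∀ x ∈ A, ∃ U ∈ 𝓝 x, ∃ C : ℝ≥0, HolderOnWith C γ (iteratedFDeriv ℝ k f) (U ∩ A)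

end RoughRIE

end

namespace RoughRIE

/-! ### The sewing estimate -/

/-! Write `F = f(S)`, `F' = Df(S)`, `a = 1/p`, `b = 1/q`. The integral comes from sewing the germ
`Ξ_{s,t} = Y_s · F_{s,t} + Y'_s F'_s 𝕊_{s,t}`. By Chen's relation the defect `Ξ_{s,t} - Ξ_{s,u} -
Ξ_{u,t}` consists only of terms of order at least `2a + b`, and `2a + b > 1` is the hypothesis on
`p` and `q`.

All variation bounds are phrased through increments of one monotone function `V`: a superadditive
`c` satisfies `c(s,t) ≤ c(0,t) - c(0,s)`. Since `c` need not be continuous, neither need `V`, so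
increments of `V` do not become small with the mesh. Smallness comes instead from the uniform
continuity of `S` and of the limit integral `J`: if the increments of `S` and `𝕊` are at most `η`,
interpolation gives a defect of at most `K η^κ (V t - V s)^θ`, where `κ > 0` is small enough to keep
`θ = b + 2a(1 - κ)` above 1. The estimate `discrete_sewing` then shows that any two sums over
partitions of fine mesh are close, uniformly in the endpoint (`exists_mesh_compare`), which yields
the first claim.

For the second claim the compensators along the given partitions must vanish in the limit. On a cell
of the `n`-th partition, `𝕊` is exactly the increment of the error `Z = J - ∫ S^n ⊗ dS`. This error
is uniformly small, and (RIE) bounds its increments by `4 (V t - V s)^(2a)` independently of `n`.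
The compensators thus form a Young sum of `Y'F'` against `Z`, which the same interpolation and
`discrete_sewing` make small (`exists_contract_sum_le`).

From `f` only Taylor estimates of second order on the compact image of `S` are needed
(`exists_taylor_bounds`). -/

theorem exists_crossing (ω : ℕ → ℝ) {i j : ℕ} (h : i < j) {c : ℝ} (hi : ω i ≤ c) (hj : c ≤ ω j) :
    ∃ m, i ≤ m ∧ m < j ∧ ω m ≤ c ∧ c ≤ ω (m + 1) := by
  induction j, h using Nat.le_induction with
  | base => exact ⟨i, le_rfl, Nat.lt_succ_self i, hi, hj⟩
  | succ j hij ih =>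
    rcases le_total c (ω j) with hc | hc
    · obtain ⟨m, h1, h2, h3⟩ := ih hc
      exact ⟨m, h1, h2.trans (Nat.lt_succ_self j), h3⟩
    · exact ⟨j, (Nat.le_succ i).trans hij, Nat.lt_succ_self j, hc, hj⟩

/-- The constant in the sewing estimate with exponent `θ`. -/
noncomputable def sewingConst (θ : ℝ) : ℝ := 2 / (1 - 2 ^ (1 - θ))

theorem sewingConst_aux {θ : ℝ} (hθ : 1 < θ) : (2 : ℝ) ^ (1 - θ) < 1 :=
  Real.rpow_lt_one_of_one_lt_of_neg one_lt_two (by linarith)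

theorem sewingConst_nonneg {θ : ℝ} (hθ : 1 < θ) : 0 ≤ sewingConst θ :=
  div_nonneg zero_le_two (by linarith [sewingConst_aux hθ])

/-- This fixed-point equation closes the sewing induction: 2 counts the two defects produced by one
cut, and `2 ^ (1 - θ)` is two halves, each contributing `2 ^ (-θ)`. -/
theorem sewingConst_eq {θ : ℝ} (hθ : 1 < θ) :
    2 + sewingConst θ * 2 ^ (1 - θ) = sewingConst θ := by
  have h : (1 - 2 ^ (1 - θ) : ℝ) ≠ 0 := by linarith [sewingConst_aux hθ]
  unfold sewingConst
  field_simp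
  ring

theorem discrete_sewing {E : Type*} [NormedAddCommGroup E] {θ K : ℝ} (hθ : 1 < θ) (hK : 0 ≤ K)
    (Ξ : ℕ → ℕ → E) (ω : ℕ → ℝ) {N : ℕ} (hω : MonotoneOn ω (Iic N))
    (h0 : ∀ i ≤ N, Ξ i i = 0)
    (hδ : ∀ i j k, i ≤ j → j ≤ k → k ≤ N →
      ‖Ξ i k - Ξ i j - Ξ j k‖ ≤ K * (ω k - ω i) ^ θ)
    {i j : ℕ} (hij : i ≤ j) (hj : j ≤ N) :
    ‖Ξ i j - ∑ k ∈ Finset.Ico i j, Ξ k (k + 1)‖ ≤ sewingConst θ * K * (ω j - ω i) ^ θ := by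
  have hC := sewingConst_nonneg hθ
  induction hn : j - i using Nat.strong_induction_on generalizing i j with
  | _ n ih =>
  have mono : ∀ a b, a ≤ b → b ≤ N → ω a ≤ ω b := fun a b hab hb =>
    hω (hab.trans hb) hb hab
  rcases hij.eq_or_lt with rfl | hlt
  · simp [h0 i hj, Real.zero_rpow (by linarith : θ ≠ 0)]
  have hw := mono i j hij hj
  -- Cut where `ω` crosses its midpoint: both `[i, m]` and `[m + 1, j]` carry at most half of the
  -- control, while the crossing cell is itself a summand and costs nothing. No continuity of `ω` is
  -- needed.
  obtain ⟨m, him, hmj, hm1, hm2⟩ :=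
    exists_crossing ω hlt (c := (ω i + ω j) / 2) (by linarith) (by linarith)
  have e1 := ih (m - i) (by omega) him (by omega) rfl
  have e2 := ih (j - (m + 1)) (by omega) (i := m + 1) (j := j) hmj hj rfl
  have d1 := hδ i m j him hmj.le hj
  have d2 := hδ m (m + 1) j (Nat.le_succ m) hmj hj
  have hhalf : ∀ x, 0 ≤ x → x ≤ (ω j - ω i) / 2 →
      sewingConst θ * K * x ^ θ ≤ sewingConst θ * K * (2 ^ (1 - θ) / 2 * (ω j - ω i) ^ θ) := by
    intro x hx hx'
    have h1 : x ^ θ ≤ ((ω j - ω i) / 2) ^ θ := Real.rpow_le_rpow hx hx' (by linarith)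
    rw [Real.div_rpow (by linarith) zero_le_two] at h1
    have h2 : (2 : ℝ) ^ (1 - θ) = 2 / 2 ^ θ := by
      rw [Real.rpow_sub two_pos, Real.rpow_one]
    have h3 : (2 : ℝ) ^ θ ≠ 0 := (Real.rpow_pos_of_pos two_pos θ).ne'
    rw [h2]
    refine mul_le_mul_of_nonneg_left (h1.trans (le_of_eq ?_)) (mul_nonneg hC hK)
    field_simp
  have b1 := hhalf (ω m - ω i) (by linarith [mono i m him (by omega)]) (by linarith)
  have b2 := hhalf (ω j - ω (m + 1)) (by linarith [mono (m + 1) j hmj hj]) (by linarith)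
  have b3 : K * (ω j - ω m) ^ θ ≤ K * (ω j - ω i) ^ θ :=
    mul_le_mul_of_nonneg_left (Real.rpow_le_rpow (by linarith [mono m j hmj.le hj])
      (by linarith [mono i m him (by omega)]) (by linarith)) hK
  have hsum : ∑ k ∈ Finset.Ico i j, Ξ k (k + 1) =
      ∑ k ∈ Finset.Ico i m, Ξ k (k + 1) + Ξ m (m + 1) +
        ∑ k ∈ Finset.Ico (m + 1) j, Ξ k (k + 1) := by
    rw [← Finset.sum_Ico_consecutive _ him hmj.le, Finset.sum_eq_sum_Ico_succ_bot hmj, add_assoc]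
  have hsplit : Ξ i j - ∑ k ∈ Finset.Ico i j, Ξ k (k + 1) =
      (Ξ i j - Ξ i m - Ξ m j) + (Ξ m j - Ξ m (m + 1) - Ξ (m + 1) j) +
      (Ξ i m - ∑ k ∈ Finset.Ico i m, Ξ k (k + 1)) +
      (Ξ (m + 1) j - ∑ k ∈ Finset.Ico (m + 1) j, Ξ k (k + 1)) := by
    rw [hsum]; abel
  rw [hsplit]
  refine (norm_add₄_le).trans ?_
  have hfin : K * (ω j - ω i) ^ θ + K * (ω j - ω i) ^ θ +
      sewingConst θ * K * (2 ^ (1 - θ) / 2 * (ω j - ω i) ^ θ) +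
      sewingConst θ * K * (2 ^ (1 - θ) / 2 * (ω j - ω i) ^ θ) =
      sewingConst θ * K * (ω j - ω i) ^ θ := by
    linear_combination (K * (ω j - ω i) ^ θ) * sewingConst_eq hθ
  linarith

theorem clamp_mem {a b x : ℝ} (hab : a ≤ b) : max a (min x b) ∈ Icc a b :=
  ⟨le_max_left _ _, max_le hab (min_le_right _ _)⟩

theorem clamp_mono (a b : ℝ) {x y : ℝ} (h : x ≤ y) : max a (min x b) ≤ max a (min y b) :=
  max_le_max le_rfl (min_le_min h le_rfl)

section Sewing

variable {E : Type*} [NormedAddCommGroup E] {T θ K δ : ℝ} {Ξ : ℝ → ℝ → E} {V : ℝ → ℝ}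

/-- Clamping the points of `v` to `[a, b]` turns cells outside the interval into degenerate ones, on
which `Ξ` vanishes; `discrete_sewing` applies to the clamped points. -/
theorem sewing_interval (hθ : 1 < θ) (hK : 0 ≤ K) (hV : MonotoneOn V (Icc 0 T))
    (h0 : ∀ s ∈ Icc 0 T, Ξ s s = 0)
    (hδ : ∀ s u t, 0 ≤ s → s ≤ u → u ≤ t → t ≤ T → t - s ≤ δ →
      ‖Ξ s t - Ξ s u - Ξ u t‖ ≤ K * (V t - V s) ^ θ)
    {a b : ℝ} (ha : 0 ≤ a) (hab : a ≤ b) (hb : b ≤ T) (hbδ : b - a ≤ δ)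
    {v : ℕ → ℝ} {M : ℕ} (hv : MonotoneOn v (Iic M)) (hv0 : v 0 ≤ a) (hvM : b ≤ v M) :
    ‖Ξ a b - ∑ j ∈ Finset.range M,
        Ξ (max a (min (v j) b)) (max a (min (v (j + 1)) b))‖ ≤
      sewingConst θ * K * (V b - V a) ^ θ := by
  have hmem : ∀ x, max a (min x b) ∈ Icc 0 T := fun x =>
    ⟨ha.trans (clamp_mem hab).1, (clamp_mem hab).2.trans hb⟩
  have hmono : ∀ i j, i ≤ j → j ≤ M → max a (min (v i) b) ≤ max a (min (v j) b) :=
    fun i j hij hj => clamp_mono a b (hv (hij.trans hj) hj hij)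
  have key := discrete_sewing hθ hK (fun i j => Ξ (max a (min (v i) b)) (max a (min (v j) b)))
    (fun i => V (max a (min (v i) b))) (N := M)
    (fun i hi j hj hij => hV (hmem _) (hmem _) (hmono i j hij hj))
    (fun i _ => h0 _ (hmem _))
    (fun i j k hij hjk hk => hδ _ _ _ (hmem _).1 (hmono i j hij (hjk.trans hk))
      (hmono j k hjk hk) (hmem _).2
      (by linarith [(clamp_mem (x := v i) hab).1, (clamp_mem (x := v k) hab).2]))
    (Nat.zero_le M) le_rfl
  have e0 : max a (min (v 0) b) = a := by
    rw [min_eq_left (hv0.trans hab), max_eq_left hv0]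
  have eM : max a (min (v M) b) = b := by rw [min_eq_right hvM, max_eq_right hab]
  simpa only [e0, eM, ← Finset.range_eq_Ico] using key

theorem sum_rpow_le (hθ : 1 < θ) (hV : MonotoneOn V (Icc 0 T)) {u : ℕ → ℝ} {N : ℕ}
    (hu : MonotoneOn u (Iic N)) (hu0 : 0 ≤ u 0) (huN : u N ≤ T) :
    ∑ k ∈ Finset.range N, (V (u (k + 1)) - V (u k)) ^ θ ≤ (V T - V 0) ^ θ := by
  have hmem : ∀ k ≤ N, u k ∈ Icc 0 T := fun k hk =>
    ⟨hu0.trans (hu (Nat.zero_le N) hk (Nat.zero_le k)), (hu hk (mem_Iic.2 le_rfl) hk).trans huN⟩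
  have h0N := hmem 0 (Nat.zero_le N)
  have hT : (0 : ℝ) ≤ T := h0N.1.trans h0N.2
  have hlo : ∀ x ∈ Icc 0 T, V 0 ≤ V x := fun x hx => hV ⟨le_rfl, hT⟩ hx hx.1
  have hhi : ∀ x ∈ Icc 0 T, V x ≤ V T := fun x hx => hV hx ⟨hT, le_rfl⟩ hx.2
  have hD : 0 ≤ V T - V 0 := by linarith [hhi 0 ⟨le_rfl, hT⟩]
  have hsplit : ∀ x : ℝ, 0 ≤ x → x ^ θ = x ^ (θ - 1) * x := fun x hx => by
    rw [← Real.rpow_add_one' hx (by linarith), sub_add_cancel]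
  calc ∑ k ∈ Finset.range N, (V (u (k + 1)) - V (u k)) ^ θ
      ≤ ∑ k ∈ Finset.range N, (V T - V 0) ^ (θ - 1) * (V (u (k + 1)) - V (u k)) := by
        refine Finset.sum_le_sum fun k hk => ?_
        have hk := Finset.mem_range.1 hk
        have h1 := hmem k hk.le
        have h2 := hmem (k + 1) hk
        have h3 := hV h1 h2 (hu (mem_Iic.2 hk.le) (mem_Iic.2 hk) (Nat.le_succ k))
        rw [hsplit _ (by linarith)]
        exact mul_le_mul_of_nonneg_right (Real.rpow_le_rpow (by linarith)
          (by linarith [hlo _ h1, hhi _ h2]) (by linarith)) (by linarith)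
    _ = (V T - V 0) ^ (θ - 1) * (V (u N) - V (u 0)) := by
        rw [← Finset.mul_sum, Finset.sum_range_sub fun k => V (u k)]
    _ ≤ (V T - V 0) ^ (θ - 1) * (V T - V 0) :=
        mul_le_mul_of_nonneg_left
          (by linarith [hlo _ h0N, hhi _ (hmem N le_rfl)]) (Real.rpow_nonneg hD _)
    _ = (V T - V 0) ^ θ := (hsplit _ hD).symm

theorem sewing_refine (hθ : 1 < θ) (hK : 0 ≤ K) (hV : MonotoneOn V (Icc 0 T))
    (h0 : ∀ s ∈ Icc 0 T, Ξ s s = 0)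
    (hδ : ∀ s u t, 0 ≤ s → s ≤ u → u ≤ t → t ≤ T → t - s ≤ δ →
      ‖Ξ s t - Ξ s u - Ξ u t‖ ≤ K * (V t - V s) ^ θ)
    {t : ℝ} (ht : t ≤ T) {u v : ℕ → ℝ} {N M : ℕ}
    (hu : MonotoneOn u (Iic N)) (hu0 : u 0 = 0) (huN : u N = t)
    (huδ : ∀ k < N, u (k + 1) - u k ≤ δ)
    (hv : MonotoneOn v (Iic M)) (hv0 : v 0 = 0) (hvM : v M = t) :
    ‖∑ k ∈ Finset.range N, Ξ (u k) (u (k + 1)) - ∑ k ∈ Finset.range N, ∑ j ∈ Finset.range M,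
        Ξ (max (u k) (min (v j) (u (k + 1)))) (max (u k) (min (v (j + 1)) (u (k + 1))))‖ ≤
      sewingConst θ * K * (V T - V 0) ^ θ := by
  rw [← Finset.sum_sub_distrib]
  refine (norm_sum_le _ _).trans ?_
  refine le_trans (Finset.sum_le_sum (g := fun k =>
    sewingConst θ * K * (V (u (k + 1)) - V (u k)) ^ θ) fun k hk => ?_) ?_
  · have hk := Finset.mem_range.1 hk
    refine sewing_interval hθ hK hV h0 hδ ?_ ?_ ?_ (huδ k hk) hv ?_ ?_
    · exact hu0 ▸ hu (Nat.zero_le N) (mem_Iic.2 hk.le) (Nat.zero_le k)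
    · exact hu (mem_Iic.2 hk.le) (mem_Iic.2 hk) (Nat.le_succ k)
    · exact (hu (mem_Iic.2 hk) (mem_Iic.2 le_rfl) hk).trans (huN.le.trans ht)
    · rw [hv0, ← hu0]; exact hu (Nat.zero_le N) (mem_Iic.2 hk.le) (Nat.zero_le k)
    · rw [hvM, ← huN]; exact hu (mem_Iic.2 hk) (mem_Iic.2 le_rfl) hk
  · rw [← Finset.mul_sum]
    exact mul_le_mul_of_nonneg_left (sum_rpow_le hθ hV hu hu0.ge (huN.le.trans ht))
      (mul_nonneg (sewingConst_nonneg hθ) hK)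

/-- If the two intervals overlap, both sides evaluate `Ξ` on their intersection. If not, the clamped
points degenerate differently on the two sides, and both values are zero by `h0`. -/
theorem clamp_symm {T : ℝ} {Ξ : ℝ → ℝ → E} (h0 : ∀ s ∈ Icc 0 T, Ξ s s = 0) {a b x y : ℝ}
    (ha : 0 ≤ a) (hab : a ≤ b) (hb : b ≤ T) (hx : 0 ≤ x) (hxy : x ≤ y) (hy : y ≤ T) :
    Ξ (max a (min x b)) (max a (min y b)) = Ξ (max x (min a y)) (max x (min b y)) := by
  rcases le_total b x with h | h
  · rw [min_eq_right h, min_eq_right (h.trans hxy), max_eq_right hab,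
      min_eq_left (hab.trans (h.trans hxy)), min_eq_left (h.trans hxy), max_eq_left (hab.trans h),
      max_eq_left h, h0 b ⟨ha.trans hab, hb⟩, h0 x ⟨hx, hxy.trans hy⟩]
  rcases le_total y a with h' | h'
  · rw [min_eq_left (hxy.trans (h'.trans hab)), min_eq_left (h'.trans hab),
      max_eq_left (hxy.trans h'), max_eq_left h', min_eq_right h', min_eq_right (h'.trans hab),
      max_eq_right hxy, h0 a ⟨ha, hab.trans hb⟩, h0 y ⟨hx.trans hxy, hy⟩]
  · rw [min_eq_left h, min_eq_left h', max_comm a x, max_eq_right (le_min h' hab),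
      max_eq_right (le_min h hxy), min_comm]

/-- Both sums are compared with the sum over the common refinement. The power of `V` does not shrink
with the mesh; in the applications the smallness sits in `K`. -/
theorem sewing_compare (hθ : 1 < θ) (hK : 0 ≤ K) (hV : MonotoneOn V (Icc 0 T))
    (h0 : ∀ s ∈ Icc 0 T, Ξ s s = 0)
    (hδ : ∀ s u t, 0 ≤ s → s ≤ u → u ≤ t → t ≤ T → t - s ≤ δ →
      ‖Ξ s t - Ξ s u - Ξ u t‖ ≤ K * (V t - V s) ^ θ)
    {t : ℝ} (ht : t ≤ T) {u v : ℕ → ℝ} {N M : ℕ}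
    (hu : MonotoneOn u (Iic N)) (hu0 : u 0 = 0) (huN : u N = t)
    (huδ : ∀ k < N, u (k + 1) - u k ≤ δ)
    (hv : MonotoneOn v (Iic M)) (hv0 : v 0 = 0) (hvM : v M = t)
    (hvδ : ∀ k < M, v (k + 1) - v k ≤ δ) :
    ‖∑ k ∈ Finset.range N, Ξ (u k) (u (k + 1)) - ∑ k ∈ Finset.range M, Ξ (v k) (v (k + 1))‖ ≤
      2 * (sewingConst θ * K * (V T - V 0) ^ θ) := by
  have e1 := sewing_refine hθ hK hV h0 hδ ht hu hu0 huN huδ hv hv0 hvM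
  have e2 := sewing_refine hθ hK hV h0 hδ ht hv hv0 hvM hvδ hu hu0 huN
  have hsymm : ∑ k ∈ Finset.range N, ∑ j ∈ Finset.range M,
      Ξ (max (u k) (min (v j) (u (k + 1)))) (max (u k) (min (v (j + 1)) (u (k + 1)))) =
      ∑ j ∈ Finset.range M, ∑ k ∈ Finset.range N,
      Ξ (max (v j) (min (u k) (v (j + 1)))) (max (v j) (min (u (k + 1)) (v (j + 1)))) := by
    rw [Finset.sum_comm]
    refine Finset.sum_congr rfl fun j hj => Finset.sum_congr rfl fun k hk => ?_
    have hj := Finset.mem_range.1 hj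
    have hk := Finset.mem_range.1 hk
    exact clamp_symm h0 (hu0 ▸ hu (Nat.zero_le N) (mem_Iic.2 hk.le) (Nat.zero_le k))
      (hu (mem_Iic.2 hk.le) (mem_Iic.2 hk) (Nat.le_succ k))
      ((hu (mem_Iic.2 hk) (mem_Iic.2 le_rfl) hk).trans (huN.le.trans ht))
      (hv0 ▸ hv (Nat.zero_le M) (mem_Iic.2 hj.le) (Nat.zero_le j))
      (hv (mem_Iic.2 hj.le) (mem_Iic.2 hj) (Nat.le_succ j))
      ((hv (mem_Iic.2 hj) (mem_Iic.2 le_rfl) hj).trans (hvM.le.trans ht))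
  rw [hsymm] at e1
  rw [← sub_sub_sub_cancel_right _ _ (∑ j ∈ Finset.range M, ∑ k ∈ Finset.range N,
      Ξ (max (v j) (min (u k) (v (j + 1)))) (max (v j) (min (u (k + 1)) (v (j + 1)))))]
  exact (norm_sub_le _ _).trans (by linarith)

end Sewing

/-! ### Variation and controls -/

/-- Appending a point to a partition. -/
def IntervalPartition.snoc {a b c : ℝ} (P : IntervalPartition a b) (h : b < c) :
    IntervalPartition a c where
  N := P.N + 1
  t k := if k ≤ P.N then P.t k else c
  strictMono i hi j hj hij := by
    rw [mem_Iic] at hi hj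
    have hi' : i ≤ P.N := by omega
    simp only [hi', if_true]
    split_ifs with hj'
    · exact P.strictMono hi' hj' hij
    · exact ((P.strictMono.monotoneOn hi' (mem_Iic.2 le_rfl) hi').trans P.right.le).trans_lt h
  left := by simp [P.left]
  right := by simp

theorem IntervalPartition.sum_snoc {a b c : ℝ} (P : IntervalPartition a b) (h : b < c)
    {M : Type*} [AddCommMonoid M] (g : ℝ → ℝ → M) :
    ∑ k ∈ Finset.range (P.snoc h).N, g ((P.snoc h).t k) ((P.snoc h).t (k + 1)) =
      ∑ k ∈ Finset.range P.N, g (P.t k) (P.t (k + 1)) + g b c := by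
  change ∑ k ∈ Finset.range (P.N + 1), _ = _
  rw [Finset.sum_range_succ]
  congr 1
  · refine Finset.sum_congr rfl fun k hk => ?_
    have hk := Finset.mem_range.1 hk
    simp [IntervalPartition.snoc, hk.le, Nat.succ_le_of_lt hk]
  · simp [IntervalPartition.snoc, P.right]

theorem IntervalPartition.nonempty {b : ℝ} (hb : 0 ≤ b) : Nonempty (IntervalPartition 0 b) := by
  let Q : IntervalPartition 0 0 :=
    ⟨0, fun _ => 0, fun i hi j hj hij => by simp at hi hj; omega, rfl, rfl⟩
  rcases hb.eq_or_lt with rfl | h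
  · exact ⟨Q⟩
  · exact ⟨Q.snoc h⟩

theorem IntervalPartition.monotoneOn {a b : ℝ} (P : IntervalPartition a b) :
    MonotoneOn P.t (Iic P.N) := P.strictMono.monotoneOn

theorem IntervalPartition.t_mem {a b : ℝ} (P : IntervalPartition a b) {k : ℕ} (hk : k ≤ P.N) :
    P.t k ∈ Icc a b :=
  ⟨P.left.ge.trans (P.monotoneOn (Nat.zero_le _) hk (Nat.zero_le k)),
    (P.monotoneOn hk (mem_Iic.2 le_rfl) hk).trans P.right.le⟩

theorem IntervalPartition.t_le_succ {a b : ℝ} (P : IntervalPartition a b) {k : ℕ} (hk : k < P.N) :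
    P.t k ≤ P.t (k + 1) :=
  P.monotoneOn (mem_Iic.2 hk.le) (mem_Iic.2 hk) (Nat.le_succ k)

theorem IntervalPartition.sub_le_mesh {a b : ℝ} (P : IntervalPartition a b) {k : ℕ}
    (hk : k < P.N) : P.t (k + 1) - P.t k ≤ P.mesh :=
  (le_abs_self _).trans
    (le_ciSup (f := fun k : Fin P.N => |P.t (k + 1) - P.t k|) (finite_range _).bddAbove ⟨k, hk⟩)

section Variation

variable {E : Type*} [NormedAddCommGroup E] {T p : ℝ} {R : ℝ → ℝ → E}

/-- The function `V t` is the `p`-th power of the `p`-variation over `[0, t]`. Appending `t` to a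
partition of `[0, s]` shows that it grows by at least `‖R s t‖ ^ p`. -/
theorem exists_control_of_pVar_lt_top (hp : 0 < p) (h0 : ∀ s, R s s = 0)
    (h : pVar p R 0 T < ∞) :
    ∃ V : ℝ → ℝ, MonotoneOn V (Icc 0 T) ∧
      ∀ s t, 0 ≤ s → s ≤ t → t ≤ T → ‖R s t‖ ≤ (V t - V s) ^ (1 / p) := by
  let W : ℝ → ℝ≥0∞ := fun t => ⨆ P : IntervalPartition 0 t,
    ∑ k ∈ Finset.range P.N, ‖R (P.t k) (P.t (k + 1))‖ₑ ^ p
  have hWT : W T < ∞ := by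
    refine lt_of_le_of_lt (iSup_le fun P => ?_) (ENNReal.rpow_lt_top_of_nonneg hp.le h.ne)
    have h1 := le_iSup (fun P : IntervalPartition 0 T =>
      (∑ k ∈ Finset.range P.N, ‖R (P.t k) (P.t (k + 1))‖ₑ ^ p) ^ (1 / p)) P
    have h2 := ENNReal.rpow_le_rpow h1 hp.le
    rwa [← ENNReal.rpow_mul, one_div_mul_cancel hp.ne', ENNReal.rpow_one] at h2
  have hadd : ∀ s t, 0 ≤ s → s ≤ t → W s + ‖R s t‖ₑ ^ p ≤ W t := by
    intro s t hs hst
    rcases hst.eq_or_lt with rfl | hlt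
    · simp [h0, hp]
    have := IntervalPartition.nonempty hs
    rw [ENNReal.iSup_add]
    refine iSup_le fun P => ?_
    rw [← P.sum_snoc hlt fun x y => ‖R x y‖ₑ ^ p]
    exact le_iSup (fun P : IntervalPartition 0 t =>
      ∑ k ∈ Finset.range P.N, ‖R (P.t k) (P.t (k + 1))‖ₑ ^ p) (P.snoc hlt)
  have hmono : ∀ s t, 0 ≤ s → s ≤ t → W s ≤ W t := fun s t hs hst =>
    le_self_add.trans (hadd s t hs hst)
  have hfin : ∀ t, 0 ≤ t → t ≤ T → W t ≠ ∞ := fun t h0 ht =>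
    ((hmono t T h0 ht).trans_lt hWT).ne
  refine ⟨fun t => (W t).toReal, fun s hs t ht hst =>
    ENNReal.toReal_mono (hfin t ht.1 ht.2) (hmono s t hs.1 hst), fun s t hs hst ht => ?_⟩
  have h1 := ENNReal.toReal_mono (hfin t (hs.trans hst) ht) (hadd s t hs hst)
  rw [ENNReal.toReal_add (hfin s hs (hst.trans ht)) (by simp [hp.le]),
    ← ENNReal.toReal_rpow, toReal_enorm] at h1
  rw [one_div, Real.le_rpow_inv_iff_of_pos (norm_nonneg _)
    (sub_nonneg.2 (ENNReal.toReal_mono (hfin t (hs.trans hst) ht) (hmono s t hs hst))) hp]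
  linarith

theorem pVar_lt_top_of_control (hp : 0 < p) {V : ℝ → ℝ} (hV : MonotoneOn V (Icc 0 T)) {C : ℝ}
    (hC : 0 ≤ C)
    (hR : ∀ s t, 0 ≤ s → s ≤ t → t ≤ T → ‖R s t‖ ≤ C * (V t - V s) ^ (1 / p)) :
    pVar p R 0 T < ∞ := by
  refine lt_of_le_of_lt (iSup_le fun P => ENNReal.rpow_le_rpow
    (z := 1 / p) (y := ENNReal.ofReal (C ^ p * (V T - V 0))) ?_ (by positivity))
    (ENNReal.rpow_lt_top_of_nonneg (by positivity) ENNReal.ofReal_ne_top)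
  have hinc : ∀ k < P.N, 0 ≤ V (P.t (k + 1)) - V (P.t k) := fun k hk =>
    sub_nonneg.2 (hV (P.t_mem hk.le) (P.t_mem hk) (P.t_le_succ hk))
  have hsum : C ^ p * (V T - V 0) =
      ∑ k ∈ Finset.range P.N, C ^ p * (V (P.t (k + 1)) - V (P.t k)) := by
    rw [← Finset.mul_sum, Finset.sum_range_sub fun k => V (P.t k), P.left, P.right]
  rw [hsum, ENNReal.ofReal_sum_of_nonneg fun k hk =>
    mul_nonneg (Real.rpow_nonneg hC p) (hinc k (Finset.mem_range.1 hk))]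
  refine Finset.sum_le_sum fun k hk => ?_
  have hk := Finset.mem_range.1 hk
  have h1 := hR _ _ (P.t_mem hk.le).1 (P.t_le_succ hk) (P.t_mem hk).2
  have h2 := Real.rpow_le_rpow (norm_nonneg _) h1 hp.le
  rw [Real.mul_rpow hC (Real.rpow_nonneg (hinc k hk) _), ← Real.rpow_mul (hinc k hk),
    one_div_mul_cancel hp.ne', Real.rpow_one] at h2
  rw [← ofReal_norm, ENNReal.ofReal_rpow_of_nonneg (norm_nonneg _) hp.le]
  exact ENNReal.ofReal_le_ofReal h2

end Variation

theorem rpow_le_rpow_sub_mul_rpow {w M a b : ℝ} (hw : 0 ≤ w) (hM : w ≤ M) (hb : 0 ≤ b)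
    (hab : b ≤ a) : w ^ a ≤ M ^ (a - b) * w ^ b := by
  calc w ^ a = w ^ (a - b) * w ^ b := by
        rw [← Real.rpow_add_of_nonneg hw (by linarith) hb, sub_add_cancel]
    _ ≤ _ := mul_le_mul_of_nonneg_right (Real.rpow_le_rpow hw hM (by linarith))
        (Real.rpow_nonneg hw b)

theorem le_rpow_mul_rpow_interpolate {x η y κ : ℝ} (hx : 0 ≤ x) (h1 : x ≤ η) (h2 : x ≤ y)
    (hκ : 0 ≤ κ) (hκ1 : κ ≤ 1) : x ≤ η ^ κ * y ^ (1 - κ) := by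
  calc x = x ^ κ * x ^ (1 - κ) := by
        rw [← Real.rpow_add_of_nonneg hx hκ (by linarith), add_sub_cancel, Real.rpow_one]
    _ ≤ _ := mul_le_mul (Real.rpow_le_rpow hx h1 hκ) (Real.rpow_le_rpow hx h2 (by linarith))
        (Real.rpow_nonneg hx _) (Real.rpow_nonneg (hx.trans h1) _)

/-! ### Taylor estimates on compact sets -/

/-- Compactness of `K ×ˢ K` globalises the bound: near the diagonal it is the local hypothesis, and
away from it `φ` is locally bounded while the distance is bounded below. This avoids any convexity
of `K`, which will be the image of a path. -/
theorem exists_le_mul_dist_pow {X : Type*} [MetricSpace X] {K : Set X} (hK : IsCompact K)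
    (φ : X → X → ℝ) (n : ℕ)
    (hloc : ∀ x ∈ K, ∃ U ∈ 𝓝 x, ∃ C, ∀ y ∈ U, ∀ z ∈ U, φ y z ≤ C * dist y z ^ n)
    (hcont : ∀ x ∈ K, ∀ y ∈ K, ContinuousAt (Function.uncurry φ) (x, y)) :
    ∃ C, 0 ≤ C ∧ ∀ x ∈ K, ∀ y ∈ K, φ x y ≤ C * dist x y ^ n := by
  have key : ∃ C, 0 ≤ C ∧ ∀ z ∈ K ×ˢ K, φ z.1 z.2 ≤ C * dist z.1 z.2 ^ n := by
    refine (hK.prod hK).induction_on (p := fun s => ∃ C, 0 ≤ C ∧ ∀ z ∈ s, φ z.1 z.2 ≤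
      C * dist z.1 z.2 ^ n) ⟨0, le_rfl, by simp⟩ ?_ ?_ ?_
    · rintro s t hst ⟨C, hC, h⟩
      exact ⟨C, hC, fun z hz => h z (hst hz)⟩
    · rintro s t ⟨C, hC, h⟩ ⟨D, hD, h'⟩
      refine ⟨C + D, add_nonneg hC hD, fun z hz => ?_⟩
      have hd : 0 ≤ dist z.1 z.2 ^ n := pow_nonneg dist_nonneg n
      rw [add_mul]
      rcases hz with hz | hz
      · linarith [h z hz, mul_nonneg hD hd]
      · linarith [h' z hz, mul_nonneg hC hd]
    · rintro ⟨x, y⟩ ⟨hx, hy⟩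
      by_cases hxy : x = y
      · subst hxy
        obtain ⟨U, hU, C, h⟩ := hloc x hx
        refine ⟨U ×ˢ U, mem_nhdsWithin_of_mem_nhds (prod_mem_nhds hU hU), |C|, abs_nonneg C,
          fun z hz => (h z.1 hz.1 z.2 hz.2).trans ?_⟩
        exact mul_le_mul_of_nonneg_right (le_abs_self C) (pow_nonneg dist_nonneg n)
      · have hpos : 0 < dist x y ^ n := pow_pos (dist_pos.2 hxy) n
        have h1 : ∀ᶠ z : X × X in 𝓝 (x, y), φ z.1 z.2 < |φ x y| + 1 :=
          (hcont x hx y hy).eventually_lt_const (lt_of_le_of_lt (le_abs_self _) (lt_add_one _))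
        have h2 : ∀ᶠ z : X × X in 𝓝 (x, y), dist x y ^ n / 2 < dist z.1 z.2 ^ n := by
          have : Continuous fun z : X × X => dist z.1 z.2 ^ n := by fun_prop
          exact this.continuousAt.eventually_const_lt (half_lt_self hpos)
        refine ⟨{z | φ z.1 z.2 < |φ x y| + 1 ∧ dist x y ^ n / 2 < dist z.1 z.2 ^ n},
          mem_nhdsWithin_of_mem_nhds (h1.and h2), (|φ x y| + 1) / (dist x y ^ n / 2),
          by positivity, fun z hz => hz.1.le.trans ?_⟩
        rw [div_mul_eq_mul_div, le_div_iff₀ (by positivity)]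
        exact mul_le_mul_of_nonneg_left hz.2.le (by positivity)
  obtain ⟨C, hC, h⟩ := key
  exact ⟨C, hC, fun x hx y hy => h (x, y) ⟨hx, hy⟩⟩

section Taylor

variable {E F : Type*} [NormedAddCommGroup E] [NormedSpace ℝ E] [NormedAddCommGroup F]
  [NormedSpace ℝ F] {A K : Set E} {f : E → F}

theorem exists_lipschitz_nhds {G : Type*} [NormedAddCommGroup G] [NormedSpace ℝ G] {g : E → G}
    {x : E} (hg : ContDiffAt ℝ 1 g x) :
    ∃ U ∈ 𝓝 x, ∃ C : ℝ, ∀ y ∈ U, ∀ z ∈ U, ‖g z - g y‖ ≤ C * dist y z := by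
  obtain ⟨C, U, hU, h⟩ := hg.exists_lipschitzOnWith
  refine ⟨U, hU, C, fun y hy z hz => ?_⟩
  rw [← dist_eq_norm, dist_comm y z]
  exact h.dist_le_mul z hz y hy

theorem exists_taylor_nhds {x : E} (hf : ContDiffAt ℝ 2 f x) :
    ∃ U ∈ 𝓝 x, ∃ C : ℝ, ∀ y ∈ U, ∀ z ∈ U,
      ‖f z - f y - fderiv ℝ f y (z - y)‖ ≤ C * dist y z ^ 2 := by
  obtain ⟨C, U, hU, h⟩ := (hf.fderiv_right (m := 1) (by norm_num)).exists_lipschitzOnWith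
  have hd : ∀ᶠ y in 𝓝 x, DifferentiableAt ℝ f y :=
    (hf.eventually (by simp)).mono fun y hy => hy.differentiableAt (by norm_num)
  obtain ⟨r, hr, hball⟩ := Metric.mem_nhds_iff.1 (inter_mem hU hd)
  refine ⟨_, Metric.ball_mem_nhds x hr, C, fun y hy z hz => ?_⟩
  have hseg : segment ℝ y z ⊆ Metric.ball x r := (convex_ball x r).segment_subset hy hz
  have := (convex_segment y z).norm_image_sub_le_of_norm_fderiv_le' (𝕜 := ℝ) (f := f)
    (φ := fderiv ℝ f y) (C := C * dist y z)
    (fun w hw => (hball (hseg hw)).2) (fun w hw => ?_)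
    (left_mem_segment ℝ y z) (right_mem_segment ℝ y z)
  · refine this.trans (le_of_eq ?_)
    rw [← dist_eq_norm, dist_comm z y]; ring
  · rw [← dist_eq_norm]
    refine (h.dist_le_mul w (hball (hseg hw)).1 y (hball hy).1).trans ?_
    refine mul_le_mul_of_nonneg_left ?_ C.2
    rw [dist_comm]
    linarith [dist_add_dist_of_mem_segment hw, dist_nonneg (x := w) (y := z)]

theorem exists_taylor_bounds (hA : IsOpen A) (hf : ContDiffOn ℝ 2 f A) (hK : IsCompact K)
    (hKA : K ⊆ A) :
    ∃ C, 0 ≤ C ∧ ∀ x ∈ K, ∀ y ∈ K,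
      ‖f y - f x‖ ≤ C * ‖y - x‖ ∧ ‖fderiv ℝ f y - fderiv ℝ f x‖ ≤ C * ‖y - x‖ ∧
      ‖f y - f x - fderiv ℝ f x (y - x)‖ ≤ C * ‖y - x‖ ^ 2 := by
  have hfa : ∀ x ∈ K, ContDiffAt ℝ 2 f x := fun x hx => hf.contDiffAt (hA.mem_nhds (hKA hx))
  have hc1 : ∀ x ∈ K, ContinuousAt f x := fun x hx => (hfa x hx).continuousAt
  have hd1 : ∀ x ∈ K, ContDiffAt ℝ 1 (fderiv ℝ f) x := fun x hx =>
    (hfa x hx).fderiv_right (by norm_num)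
  have hc2 : ∀ x ∈ K, ContinuousAt (fderiv ℝ f) x := fun x hx => (hd1 x hx).continuousAt
  obtain ⟨C1, h1, H1⟩ := exists_le_mul_dist_pow hK (fun y z => ‖f z - f y‖) 1
    (fun x hx => by simpa using exists_lipschitz_nhds ((hfa x hx).of_le (by norm_num)))
    (fun x hx y hy => ((ContinuousAt.snd'' (x := (x, y)) (hc1 y hy)).sub
      (ContinuousAt.fst'' (x := (x, y)) (hc1 x hx))).norm)
  obtain ⟨C2, h2, H2⟩ := exists_le_mul_dist_pow hK (fun y z => ‖fderiv ℝ f z - fderiv ℝ f y‖) 1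
    (fun x hx => by simpa using exists_lipschitz_nhds (hd1 x hx))
    (fun x hx y hy => ((ContinuousAt.snd'' (x := (x, y)) (hc2 y hy)).sub
      (ContinuousAt.fst'' (x := (x, y)) (hc2 x hx))).norm)
  obtain ⟨C3, h3, H3⟩ := exists_le_mul_dist_pow hK
    (fun y z => ‖f z - f y - fderiv ℝ f y (z - y)‖) 2
    (fun x hx => exists_taylor_nhds (hfa x hx))
    (fun x hx y hy => (((ContinuousAt.snd'' (x := (x, y)) (hc1 y hy)).sub
      (ContinuousAt.fst'' (x := (x, y)) (hc1 x hx))).sub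
      ((ContinuousAt.fst'' (x := (x, y)) (hc2 x hx)).clm_apply
        (continuousAt_snd.sub continuousAt_fst))).norm)
  refine ⟨C1 + C2 + C3, by positivity, fun x hx y hy => ?_⟩
  have e1 := H1 x hx y hy
  have e2 := H2 x hx y hy
  have e3 := H3 x hx y hy
  rw [dist_comm, dist_eq_norm] at e1 e2 e3
  have n1 := norm_nonneg (y - x)
  have n2 := sq_nonneg ‖y - x‖
  refine ⟨e1.trans ?_, e2.trans ?_, e3.trans ?_⟩
  · rw [pow_one]; exact mul_le_mul_of_nonneg_right (by linarith) n1
  · rw [pow_one]; exact mul_le_mul_of_nonneg_right (by linarith) n1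
  · exact mul_le_mul_of_nonneg_right (by linarith) n2

end Taylor

/-! ### Tensors and contractions -/

section Algebra

variable {d m : ℕ}

theorem tensor_sub_right (a b c : Vec d) : tensor a (b - c) = tensor a b - tensor a c := by
  ext ij; simp [tensor, mul_sub]

theorem tensor_sub_left (a b c : Vec d) : tensor (a - b) c = tensor a c - tensor b c := by
  ext ij; simp [tensor, sub_mul]

theorem tensor_zero_right (a : Vec d) : tensor a 0 = 0 := by
  ext ij; simp [tensor]

theorem norm_tensor (a b : Vec d) : ‖tensor a b‖ = ‖a‖ * ‖b‖ := by
  rw [← sq_eq_sq₀ (norm_nonneg _) (by positivity), mul_pow, EuclideanSpace.norm_sq_eq,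
    EuclideanSpace.norm_sq_eq, EuclideanSpace.norm_sq_eq, Fintype.sum_mul_sum,
    ← Fintype.sum_prod_type']
  simp [tensor, mul_pow]

theorem continuous_tensor : Continuous fun x : Vec d × Vec d => tensor x.1 x.2 := by
  unfold tensor; fun_prop

variable (A B : Vec d →L[ℝ] Vec m) (M N : Mat d)

theorem contract_add_right : contract A B (M + N) = contract A B M + contract A B N := by
  simp [contract, mul_add, Finset.sum_add_distrib]

theorem contract_zero_right : contract A B 0 = 0 := by
  simp [contract]

theorem contract_sub_left (A' : Vec d →L[ℝ] Vec m) :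
    contract (A - A') B M = contract A B M - contract A' B M := by
  simp [contract, sub_mul, Finset.sum_sub_distrib]

theorem contract_sub_middle (B' : Vec d →L[ℝ] Vec m) :
    contract A (B - B') M = contract A B M - contract A B' M := by
  simp [contract, sub_mul, mul_sub, Finset.sum_sub_distrib]

theorem apply_eq_sum_single (a : Vec d) (i : Fin m) :
    A a i = ∑ j, A (EuclideanSpace.single j 1) i * a j := by
  conv_lhs => rw [← (EuclideanSpace.basisFun (Fin d) ℝ).sum_repr a]
  simp [mul_comm]

theorem contract_tensor (a b : Vec d) : contract A B (tensor a b) = inner ℝ (A a) (B b) := by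
  rw [PiLp.inner_apply]
  refine Finset.sum_congr rfl fun i _ => ?_
  rw [apply_eq_sum_single A a i, apply_eq_sum_single B b i]
  simp only [tensor, RCLike.inner_apply, conj_trivial, Finset.sum_mul_sum]
  rw [Finset.sum_comm]
  refine Finset.sum_congr rfl fun j _ => Finset.sum_congr rfl fun l _ => ?_
  ring

theorem abs_contract_le : |contract A B M| ≤ (m * d * d) * (‖A‖ * ‖B‖ * ‖M‖) := by
  have hcoord : ∀ (A : Vec d →L[ℝ] Vec m) (i : Fin m) (j : Fin d),
      |A (EuclideanSpace.single j 1) i| ≤ ‖A‖ := fun A i j => by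
    have h1 := A.le_opNorm (EuclideanSpace.single j 1)
    rw [PiLp.norm_single, norm_one, mul_one] at h1
    exact (PiLp.norm_apply_le (A (EuclideanSpace.single j 1)) i).trans h1
  have h : ∀ i j l, |A (EuclideanSpace.single j 1) i * B (EuclideanSpace.single l 1) i * M (j, l)|
      ≤ ‖A‖ * ‖B‖ * ‖M‖ := fun i j l => by
    rw [abs_mul, abs_mul]
    have h3 : |M (j, l)| ≤ ‖M‖ := PiLp.norm_apply_le M (j, l)
    gcongr
    · exact hcoord A i j
    · exact hcoord B i l
  calc |contract A B M| ≤ ∑ _i : Fin m, ∑ _j : Fin d, ∑ _l : Fin d, ‖A‖ * ‖B‖ * ‖M‖ := by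
        refine (Finset.abs_sum_le_sum_abs _ _).trans (Finset.sum_le_sum fun i _ => ?_)
        refine (Finset.abs_sum_le_sum_abs _ _).trans (Finset.sum_le_sum fun j _ => ?_)
        exact (Finset.abs_sum_le_sum_abs _ _).trans (Finset.sum_le_sum fun l _ => h i j l)
    _ = _ := by simp; ring

end Algebra

/-! ### Riemann sums and property (RIE) -/

section RIE

variable {d : ℕ} {T : ℝ} {S : ℝ → Vec d}

/-- Within one cell the integrand is frozen at the left endpoint, and clamping annihilates the
increments of all other cells. -/
theorem tensorSum_sub (S : ℝ → Vec d) (P : IntervalPartition 0 T) {k : ℕ} (hk : k < P.N)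
    {s t : ℝ} (hs : P.t k ≤ s) (hst : s ≤ t) (ht : t ≤ P.t (k + 1)) :
    tensorSum S P t - tensorSum S P s = tensor (S (P.t k)) (incr S s t) := by
  unfold tensorSum
  rw [← Finset.sum_sub_distrib, Finset.sum_eq_single k]
  · rw [← tensor_sub_right, min_eq_left hs, min_eq_left (hs.trans hst), min_eq_right ht,
      min_eq_right (hst.trans ht)]
    congr 1
    simp [incr]
  · intro i hi hik
    have hi := Finset.mem_range.1 hi
    rw [← tensor_sub_right]
    rcases lt_or_gt_of_ne hik with h | h
    · have h1 : P.t (i + 1) ≤ s := (P.monotoneOn (mem_Iic.2 hi) (mem_Iic.2 hk.le) h).trans hs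
      have h2 : P.t i ≤ s := (P.t_le_succ hi).trans h1
      rw [min_eq_left h1, min_eq_left h2, min_eq_left (h1.trans hst), min_eq_left (h2.trans hst),
        sub_self, tensor_zero_right]
    · have h1 : t ≤ P.t i := ht.trans (P.monotoneOn (mem_Iic.2 hk) (mem_Iic.2 hi.le) h)
      have h2 : t ≤ P.t (i + 1) := h1.trans (P.t_le_succ hi)
      rw [min_eq_right h1, min_eq_right h2, min_eq_right (hst.trans h1),
        min_eq_right (hst.trans h2)]
      simp [incr, tensor_zero_right]
  · intro h
    exact absurd (Finset.mem_range.2 hk) h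

theorem continuousOn_tensorSum (hS : ContinuousOn S (Icc 0 T)) (P : IntervalPartition 0 T) :
    ContinuousOn (tensorSum S P) (Icc 0 T) := by
  unfold tensorSum
  refine continuousOn_finsetSum _ fun k hk => ?_
  have hk := Finset.mem_range.1 hk
  have hc : ∀ j ≤ P.N, ContinuousOn (fun t => S (min (P.t j) t)) (Icc 0 T) := fun j hj =>
    hS.comp (by fun_prop) fun t ht =>
      ⟨le_min (P.t_mem hj).1 ht.1, (min_le_right _ _).trans ht.2⟩
  exact continuous_tensor.comp_continuousOn
    (continuousOn_const.prodMk ((hc (k + 1) hk).sub (hc k hk.le)))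

theorem le_of_div_coe_le_one {x : ℝ≥0∞} {c : ℝ≥0} (h : x / c ≤ 1) : x ≤ c := by
  have := (ENNReal.div_le_iff_le_mul (Or.inr ENNReal.one_ne_top) (Or.inr one_ne_zero)).1 h
  rwa [one_mul] at this

theorem norm_le_rpow_of_enorm_rpow_le {E : Type*} [NormedAddCommGroup E] {x : E} {c : ℝ≥0}
    {p y : ℝ} (hp : 0 < p) (h : ‖x‖ₑ ^ p ≤ c) (hc : (c : ℝ) ≤ y) : ‖x‖ ≤ y ^ (1 / p) := by
  rw [one_div, Real.le_rpow_inv_iff_of_pos (norm_nonneg _) (c.2.trans hc) hp]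
  refine le_trans ?_ hc
  have := ENNReal.toReal_mono ENNReal.coe_ne_top h
  rwa [← ENNReal.toReal_rpow, toReal_enorm, ENNReal.coe_toReal] at this

/-- Superadditivity bounds `c s t` by `c 0 t - c 0 s`, so the monotone function `c 0` serves all
partitions at once. -/
theorem SatisfiesRIE.exists_control {p : ℝ} {P : ℕ → IntervalPartition 0 T}
    (hS : SatisfiesRIE T p P S) :
    ∃ V : ℝ → ℝ, MonotoneOn V (Icc 0 T) ∧
      (∀ s t, 0 ≤ s → s ≤ t → t ≤ T → ‖incr S s t‖ ≤ (V t - V s) ^ (1 / p)) ∧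
      ∀ n k l, k ≤ l → l ≤ (P n).N →
        ‖tensorSum S (P n) ((P n).t l) - tensorSum S (P n) ((P n).t k) -
          tensor (S ((P n).t k)) (incr S ((P n).t k) ((P n).t l))‖ ≤
            (V ((P n).t l) - V ((P n).t k)) ^ (2 / p) := by
  obtain ⟨c, hc, h⟩ := hS.control
  have hp : 0 < p := by linarith [hS.two_lt]
  have hadd : ∀ s t, 0 ≤ s → s ≤ t → t ≤ T → (c s t : ℝ) ≤ c 0 t - c 0 s := fun s t hs hst ht => by
    have h1 : ((c 0 s + c s t : ℝ≥0) : ℝ) ≤ c 0 t :=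
      NNReal.coe_le_coe.2 (hc 0 s t le_rfl hs hst ht)
    push_cast at h1
    linarith
  refine ⟨fun t => c 0 t, fun s hs t ht hst => ?_, fun s t hs hst ht => ?_, fun n k l hkl hl => ?_⟩
  · have := hadd s t hs.1 hst ht.2
    have h0 : (0 : ℝ) ≤ c s t := (c s t).2
    change (c 0 s : ℝ) ≤ c 0 t
    linarith
  · have h1 := le_self_add.trans h
    simp only [iSup_le_iff] at h1
    exact norm_le_rpow_of_enorm_rpow_le hp (le_of_div_coe_le_one (h1 s t ⟨hs, hst, ht⟩))
      (hadd s t hs hst ht)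
  · have hmem := (P n).t_mem (hkl.trans hl)
    have hmem' := (P n).t_mem hl
    rcases hkl.eq_or_lt with rfl | hlt
    · simp [incr, tensor_zero_right, Real.zero_rpow, hp.ne']
    have h1 := le_add_self.trans h
    simp only [iSup_le_iff] at h1
    have := norm_le_rpow_of_enorm_rpow_le (half_pos hp)
      (le_of_div_coe_le_one (h1 n k l ⟨hlt, hl⟩))
      (hadd _ _ hmem.1 ((P n).monotoneOn (mem_Iic.2 (hkl.trans hl)) (mem_Iic.2 hl) hkl) hmem'.2)
    rwa [one_div_div] at this

variable {a : ℝ} {V : ℝ → ℝ}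

/-- The right endpoint is freed from the partition: Chen's relation at the left end `P.t j` of a
cell containing `t` leaves the bound up to `P.t j` plus one tensor of increments, hence the factor
2. -/
theorem norm_tensorSum_sub_le (hV : MonotoneOn V (Icc 0 T)) (ha : 0 < a)
    (hSV : ∀ s t, 0 ≤ s → s ≤ t → t ≤ T → ‖incr S s t‖ ≤ (V t - V s) ^ a)
    (P : IntervalPartition 0 T)
    (hP : ∀ k l, k ≤ l → l ≤ P.N →
        ‖tensorSum S P (P.t l) - tensorSum S P (P.t k) -
          tensor (S (P.t k)) (incr S (P.t k) (P.t l))‖ ≤ (V (P.t l) - V (P.t k)) ^ (2 * a))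
    {k : ℕ} (hk : k ≤ P.N) {t : ℝ} (hkt : P.t k ≤ t) (ht : t ≤ T) :
    ‖tensorSum S P t - tensorSum S P (P.t k) - tensor (S (P.t k)) (incr S (P.t k) t)‖ ≤
      2 * (V t - V (P.t k)) ^ (2 * a) := by
  have hk0 := P.t_mem hk
  have ht0 : t ∈ Icc 0 T := ⟨hk0.1.trans hkt, ht⟩
  have hw : 0 ≤ V t - V (P.t k) := sub_nonneg.2 (hV hk0 ht0 hkt)
  rcases hk.eq_or_lt with rfl | hlt
  · have : t = P.t P.N := le_antisymm (ht.trans P.right.ge) hkt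
    subst this
    simp [incr, tensor_zero_right, Real.zero_rpow, ha.ne']
  obtain ⟨j, hkj, hj, hj1, hj2⟩ := exists_crossing P.t hlt hkt (ht.trans P.right.ge)
  have hj0 := P.t_mem hj.le
  have hkj' := P.monotoneOn (mem_Iic.2 hk) (mem_Iic.2 hj.le) hkj
  have hV1 := hV hk0 hj0 hkj'
  have hV2 := hV hj0 ht0 hj1
  have e := tensorSum_sub S P hj le_rfl hj1 hj2
  have hsplit : tensorSum S P t - tensorSum S P (P.t k) - tensor (S (P.t k)) (incr S (P.t k) t) =
      (tensorSum S P (P.t j) - tensorSum S P (P.t k) -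
        tensor (S (P.t k)) (incr S (P.t k) (P.t j))) +
      tensor (incr S (P.t k) (P.t j)) (incr S (P.t j) t) := by
    rw [← sub_add_sub_cancel (tensorSum S P t) (tensorSum S P (P.t j)), e]
    simp only [incr, tensor_sub_left, tensor_sub_right]
    abel
  rw [hsplit]
  refine (norm_add_le _ _).trans ?_
  rw [norm_tensor]
  have b1 := (hP k j hkj hj.le).trans
    (Real.rpow_le_rpow (by linarith) (by linarith : _ ≤ V t - V (P.t k)) (by linarith))
  have b2 := (hSV _ _ hk0.1 hkj' hj0.2).trans
    (Real.rpow_le_rpow (by linarith) (by linarith : _ ≤ V t - V (P.t k)) ha.le)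
  have b3 := (hSV _ _ hj0.1 hj1 ht).trans
    (Real.rpow_le_rpow (by linarith) (by linarith : _ ≤ V t - V (P.t k)) ha.le)
  have b4 := mul_le_mul b2 b3 (norm_nonneg _) (Real.rpow_nonneg hw a)
  rw [← Real.rpow_add_of_nonneg hw ha.le ha.le, ← two_mul] at b4
  linarith

/-- The left endpoint `s` is approached by partition points from the right. The approximating
intervals then lie inside `[s, t]`, so monotonicity of `V` suffices for the limit. -/
theorem norm_area_le (hV : MonotoneOn V (Icc 0 T)) (ha : 0 < a)
    (hSc : ContinuousOn S (Icc 0 T))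
    (hSV : ∀ s t, 0 ≤ s → s ≤ t → t ≤ T → ‖incr S s t‖ ≤ (V t - V s) ^ a)
    {P : ℕ → IntervalPartition 0 T} (hmesh : Tendsto (fun n => (P n).mesh) atTop (𝓝 0))
    (hP : ∀ n k l, k ≤ l → l ≤ (P n).N →
        ‖tensorSum S (P n) ((P n).t l) - tensorSum S (P n) ((P n).t k) -
          tensor (S ((P n).t k)) (incr S ((P n).t k) ((P n).t l))‖ ≤
            (V ((P n).t l) - V ((P n).t k)) ^ (2 * a))
    {J : ℝ → Mat d} (hJ : TendstoUniformlyOn (fun n t => tensorSum S (P n) t) J atTop (Icc 0 T))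
    {s t : ℝ} (hs : 0 ≤ s) (hst : s ≤ t) (ht : t ≤ T) :
    ‖J t - J s - tensor (S s) (incr S s t)‖ ≤ 2 * (V t - V s) ^ (2 * a) := by
  rcases hst.eq_or_lt with rfl | hlt
  · simp [incr, tensor_zero_right, Real.zero_rpow, ha.ne']
  have hJc : ContinuousOn J (Icc 0 T) :=
    hJ.continuousOn (Frequently.of_forall fun n => continuousOn_tensorSum hSc (P n))
  have hs0 : s ∈ Icc 0 T := ⟨hs, hst.trans ht⟩
  have ht0 : t ∈ Icc 0 T := ⟨hs.trans hst, ht⟩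
  have hex : ∀ n, ∃ j < (P n).N, (P n).t j ≤ s ∧ s ≤ (P n).t (j + 1) := fun n => by
    have hN : 0 < (P n).N := by
      rcases Nat.eq_zero_or_pos (P n).N with h | h
      · have h1 := (P n).right
        rw [h, (P n).left] at h1
        linarith
      · exact h
    obtain ⟨m, -, h1, h2⟩ := exists_crossing (P n).t hN (c := s) ((P n).left.le.trans hs)
      (hs0.2.trans (P n).right.ge)
    exact ⟨m, h1, h2⟩
  choose j hjN hj1 hj2 using hex
  have hx0 : ∀ n, (P n).t (j n + 1) ∈ Icc 0 T := fun n => (P n).t_mem (hjN n)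
  have hx : Tendsto (fun n => (P n).t (j n + 1)) atTop (𝓝 s) := by
    refine tendsto_of_tendsto_of_tendsto_of_le_of_le (g := fun _ => s)
      (h := fun n => s + (P n).mesh) tendsto_const_nhds
      (by simpa using hmesh.const_add s) hj2 fun n => ?_
    have := (P n).sub_le_mesh (hjN n)
    have := hj1 n
    show (P n).t (j n + 1) ≤ s + (P n).mesh
    linarith
  have hxw : Tendsto (fun n => (P n).t (j n + 1)) atTop (𝓝[Icc 0 T] s) :=
    tendsto_nhdsWithin_iff.2 ⟨hx, Eventually.of_forall hx0⟩
  have l1 : Tendsto (fun n => tensorSum S (P n) ((P n).t (j n + 1))) atTop (𝓝 (J s)) :=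
    hJ.tendsto_comp (hJc s hs0) hxw
  have l2 : Tendsto (fun n => S ((P n).t (j n + 1))) atTop (𝓝 (S s)) := (hSc s hs0).tendsto.comp hxw
  have l3 := (((hJ.tendsto_at ht0).sub l1).sub ((continuous_tensor.tendsto (S s, incr S s t)).comp
    (l2.prodMk_nhds (l2.const_sub (S t))))).norm
  refine le_of_tendsto l3 ?_
  filter_upwards [hx.eventually_le_const hlt] with n hn
  refine (norm_tensorSum_sub_le hV ha hSV (P n) (hP n) (hjN n) hn ht).trans ?_
  have e1 := hV hs0 (hx0 n) (hj2 n)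
  have e2 := hV (hx0 n) ht0 hn
  exact mul_le_mul_of_nonneg_left
    (Real.rpow_le_rpow (by linarith) (by linarith) (by linarith)) zero_le_two

end RIE

/-! ### Integration of controlled paths -/

section Integration

variable {d m : ℕ}

/-- The second level built from a path `S` and a candidate `J` for the integral `∫ S ⊗ dS`. -/
def secondLevel (S : ℝ → Vec d) (J : ℝ → Mat d) (s t : ℝ) : Mat d :=
  J t - J s - tensor (S s) (incr S s t)

/-- The local approximation `Y_s · F_{s,t} + Y'_s F'_s 𝕊_{s,t}` of the integral of controlled
paths. -/
noncomputable def germ (SS : ℝ → ℝ → Mat d) (Y : ℝ → Vec m) (Y' : ℝ → Vec d →L[ℝ] Vec m)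
    (F : ℝ → Vec m) (F' : ℝ → Vec d →L[ℝ] Vec m) (s t : ℝ) : ℝ :=
  inner ℝ (Y s) (incr F s t) + contract (Y' s) (F' s) (SS s t)

/-- Quantitative bounds, in terms of the increments of a monotone function `V`, under which `Y`
can be integrated against `F`. -/
structure ControlledBounds (T a b L B : ℝ) (V : ℝ → ℝ) (S : ℝ → Vec d) (J : ℝ → Mat d)
    (Y : ℝ → Vec m) (Y' : ℝ → Vec d →L[ℝ] Vec m) (F : ℝ → Vec m) (F' : ℝ → Vec d →L[ℝ] Vec m) :
    Prop where
  b_pos : 0 < b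
  b_le : b ≤ a
  one_lt : 1 < 2 * a + b
  L_nonneg : 0 ≤ L
  B_nonneg : 0 ≤ B
  mono : MonotoneOn V (Icc 0 T)
  continuousOn_path : ContinuousOn S (Icc 0 T)
  continuousOn_int : ContinuousOn J (Icc 0 T)
  path : ∀ s t, 0 ≤ s → s ≤ t → t ≤ T → ‖incr S s t‖ ≤ (V t - V s) ^ a
  area : ∀ s t, 0 ≤ s → s ≤ t → t ≤ T → ‖secondLevel S J s t‖ ≤ 2 * (V t - V s) ^ (2 * a)
  deriv : ∀ s t, 0 ≤ s → s ≤ t → t ≤ T → ‖incr Y' s t‖ ≤ (V t - V s) ^ b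
  rem : ∀ s t, 0 ≤ s → s ≤ t → t ≤ T → ‖remainder S Y Y' s t‖ ≤ (V t - V s) ^ (a + b)
  deriv_le : ∀ s ∈ Icc 0 T, ‖Y' s‖ ≤ B
  deriv_le' : ∀ s ∈ Icc 0 T, ‖F' s‖ ≤ B
  lip : ∀ s ∈ Icc 0 T, ∀ t ∈ Icc 0 T, ‖incr F s t‖ ≤ L * ‖incr S s t‖
  lip' : ∀ s ∈ Icc 0 T, ∀ t ∈ Icc 0 T, ‖incr F' s t‖ ≤ L * ‖incr S s t‖
  rem' : ∀ s ∈ Icc 0 T, ∀ t ∈ Icc 0 T, ‖remainder S F F' s t‖ ≤ L * ‖incr S s t‖ ^ 2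

theorem germ_self (S : ℝ → Vec d) (J : ℝ → Mat d) (Y : ℝ → Vec m) (Y' : ℝ → Vec d →L[ℝ] Vec m)
    (F : ℝ → Vec m) (F' : ℝ → Vec d →L[ℝ] Vec m) (s : ℝ) :
    germ (secondLevel S J) Y Y' F F' s s = 0 := by
  simp [germ, incr, secondLevel, tensor_zero_right, contract_zero_right]

/-- The tensor term in Chen's relation contributes the inner product of `Y'_s S_{s,u}` and `F'_s
S_{u,t}`, which cancels the leading part of `Y_{s,u} · F_{u,t}`. The four surviving terms have
orders `2a + b`, `3a`, `3a` and `2a + b`. -/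
theorem germ_delta (S : ℝ → Vec d) (J : ℝ → Mat d) (Y : ℝ → Vec m) (Y' : ℝ → Vec d →L[ℝ] Vec m)
    (F : ℝ → Vec m) (F' : ℝ → Vec d →L[ℝ] Vec m) (s u t : ℝ) :
    germ (secondLevel S J) Y Y' F F' s t - germ (secondLevel S J) Y Y' F F' s u -
        germ (secondLevel S J) Y Y' F F' u t =
      -inner ℝ (remainder S Y Y' s u) (incr F u t) -
        inner ℝ (Y' s (incr S s u)) (remainder S F F' u t) -
        inner ℝ (Y' s (incr S s u)) (incr F' s u (incr S u t)) -
        (contract (Y' u) (F' u) (secondLevel S J u t) -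
          contract (Y' s) (F' s) (secondLevel S J u t)) := by
  have hchen : secondLevel S J s t =
      secondLevel S J s u + secondLevel S J u t + tensor (incr S s u) (incr S u t) := by
    simp only [secondLevel, incr, tensor_sub_left, tensor_sub_right]
    abel
  have hF : incr F s t = incr F s u + incr F u t := by simp [incr]
  have hY : Y u = Y s + remainder S Y Y' s u + Y' s (incr S s u) := by
    simp only [remainder, incr]; abel
  have hF2 : incr F u t =
      remainder S F F' u t + incr F' s u (incr S u t) + F' s (incr S u t) := by
    simp only [remainder, incr, sub_apply]; abel
  simp only [germ]
  rw [hchen, contract_add_right, contract_add_right, contract_tensor, hF, inner_add_right]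
  have e1 : inner ℝ (Y u) (incr F u t) = inner ℝ (Y s) (incr F u t) +
      inner ℝ (remainder S Y Y' s u) (incr F u t) + inner ℝ (Y' s (incr S s u)) (incr F u t) := by
    rw [hY, inner_add_left, inner_add_left]
  have e2 : inner ℝ (Y' s (incr S s u)) (incr F u t) =
      inner ℝ (Y' s (incr S s u)) (remainder S F F' u t) +
      inner ℝ (Y' s (incr S s u)) (incr F' s u (incr S u t)) +
      inner ℝ (Y' s (incr S s u)) (F' s (incr S u t)) := by
    conv_lhs => rw [hF2]
    rw [inner_add_right, inner_add_right]
  linarith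

variable {T a b L B : ℝ} {V : ℝ → ℝ} {S : ℝ → Vec d} {J : ℝ → Mat d}
  {Y : ℝ → Vec m} {Y' : ℝ → Vec d →L[ℝ] Vec m} {F : ℝ → Vec m} {F' : ℝ → Vec d →L[ℝ] Vec m}

namespace ControlledBounds

theorem sub_nonneg (h : ControlledBounds T a b L B V S J Y Y' F F') {s t : ℝ} (hs : 0 ≤ s)
    (hst : s ≤ t) (ht : t ≤ T) : 0 ≤ V t - V s :=
  _root_.sub_nonneg.2 (h.mono ⟨hs, hst.trans ht⟩ ⟨hs.trans hst, ht⟩ hst)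

theorem sub_le (h : ControlledBounds T a b L B V S J Y Y' F F') {s t : ℝ} (hs : 0 ≤ s)
    (hst : s ≤ t) (ht : t ≤ T) : V t - V s ≤ V T - V 0 := by
  linarith [h.sub_nonneg le_rfl hs (hst.trans ht), h.sub_nonneg (hs.trans hst) ht le_rfl]

theorem contract_sub_le (h : ControlledBounds T a b L B V S J Y Y' F F') :
    ∃ C, 0 ≤ C ∧ ∀ s u, 0 ≤ s → s ≤ u → u ≤ T → ∀ M,
      |contract (Y' u) (F' u) M - contract (Y' s) (F' s) M| ≤ C * (V u - V s) ^ b * ‖M‖ := by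
  rcases lt_or_ge T 0 with hT | hT
  · exact ⟨0, le_rfl, fun s u hs hu ht => absurd (hs.trans (hu.trans ht)) hT.not_ge⟩
  have hD := h.sub_nonneg le_rfl hT le_rfl
  have hB := h.B_nonneg
  have hL := h.L_nonneg
  refine ⟨(m * d * d) * (B + B * (L * (V T - V 0) ^ (a - b))), by positivity,
    fun s u hs hsu hu M => ?_⟩
  have hs0 : s ∈ Icc 0 T := ⟨hs, hsu.trans hu⟩
  have hu0 : u ∈ Icc 0 T := ⟨hs.trans hsu, hu⟩
  have hw := h.sub_nonneg hs hsu hu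
  have e : contract (Y' u) (F' u) M - contract (Y' s) (F' s) M =
      contract (incr Y' s u) (F' u) M + contract (Y' s) (incr F' s u) M := by
    simp only [incr, contract_sub_left, contract_sub_middle]; ring
  have b1 := h.deriv s u hs hsu hu
  have b2 : ‖incr F' s u‖ ≤ L * ((V T - V 0) ^ (a - b) * (V u - V s) ^ b) :=
    (h.lip' s hs0 u hu0).trans (mul_le_mul_of_nonneg_left ((h.path s u hs hsu hu).trans
      (rpow_le_rpow_sub_mul_rpow hw (h.sub_le hs hsu hu) h.b_pos.le h.b_le)) hL)
  rw [e]
  calc _ ≤ _ := abs_add_le _ _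
    _ ≤ _ := add_le_add (abs_contract_le _ _ _) (abs_contract_le _ _ _)
    _ ≤ (m * d * d) * ((V u - V s) ^ b * B * ‖M‖) +
        (m * d * d) * (B * (L * ((V T - V 0) ^ (a - b) * (V u - V s) ^ b)) * ‖M‖) := by
      have := h.deriv_le' u hu0
      have := h.deriv_le s hs0
      gcongr
    _ = _ := by ring

/-- Every term of the defect contains an increment of `S` or `𝕊` over `[u, t]`; interpolating that
factor between `η` and its power of `V` extracts `η ^ κ`. -/
theorem germ_delta_le (h : ControlledBounds T a b L B V S J Y Y' F F') {κ : ℝ} (hκ : 0 ≤ κ)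
    (hκ1 : κ ≤ 1) :
    ∃ K, 0 ≤ K ∧ ∀ η s u t, 0 ≤ s → s ≤ u → u ≤ t → t ≤ T →
      ‖incr S u t‖ ≤ η → ‖secondLevel S J u t‖ ≤ η →
      ‖germ (secondLevel S J) Y Y' F F' s t - germ (secondLevel S J) Y Y' F F' s u -
        germ (secondLevel S J) Y Y' F F' u t‖ ≤
        K * η ^ κ * (V t - V s) ^ (b + 2 * a * (1 - κ)) := by
  rcases lt_or_ge T 0 with hT | hT
  · exact ⟨0, le_rfl, fun _ s u t hs hu ht h' => absurd (hs.trans (hu.trans (ht.trans h')))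
      hT.not_ge⟩
  obtain ⟨C, hC, hcon⟩ := h.contract_sub_le
  have hD := h.sub_nonneg le_rfl hT le_rfl
  have hB := h.B_nonneg
  have hL := h.L_nonneg
  have hb := h.b_pos
  have ha : 0 < a := hb.trans_le h.b_le
  have hab := h.b_le
  have hκ' : 0 ≤ 1 - κ := by linarith
  have hθ : 0 ≤ b + 2 * a * (1 - κ) := by positivity
  refine ⟨L * (V T - V 0) ^ (a * κ) + 2 * B * L * (V T - V 0) ^ (a - b + a * κ) + 2 * C,
    by positivity, fun η s u t hs hsu hut ht hη1 hη2 => ?_⟩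
  have hη : 0 ≤ η := (norm_nonneg _).trans hη1
  have hs0 : s ∈ Icc 0 T := ⟨hs, hsu.trans (hut.trans ht)⟩
  have hu0 : u ∈ Icc 0 T := ⟨hs.trans hsu, hut.trans ht⟩
  have ht0 : t ∈ Icc 0 T := ⟨hu0.1.trans hut, ht⟩
  have hsu' := h.sub_nonneg hs hsu hu0.2
  have hut' := h.sub_nonneg hu0.1 hut ht
  have hw := h.sub_nonneg hs (hsu.trans hut) ht
  have hwD := h.sub_le hs (hsu.trans hut) ht
  set w := V t - V s with hwdef
  have hsuw : V u - V s ≤ w := by linarith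
  have hutw : V t - V u ≤ w := by linarith
  have S1 : ‖incr S s u‖ ≤ w ^ a := (h.path s u hs hsu hu0.2).trans (by gcongr)
  have S2 : ‖incr S u t‖ ≤ w ^ a := (h.path u t hu0.1 hut ht).trans (by gcongr)
  have S3 : ‖secondLevel S J u t‖ ≤ 2 * w ^ (2 * a) :=
    (h.area u t hu0.1 hut ht).trans (by gcongr)
  have R1 : ‖remainder S Y Y' s u‖ ≤ w ^ (a + b) :=
    (h.rem s u hs hsu hu0.2).trans (by gcongr)
  have x1 : ‖incr S u t‖ ≤ η ^ κ * w ^ (a * (1 - κ)) := by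
    rw [Real.rpow_mul hw]
    exact le_rpow_mul_rpow_interpolate (norm_nonneg _) hη1 S2 hκ hκ1
  have x2 : ‖secondLevel S J u t‖ ≤ η ^ κ * (2 * w ^ (2 * a * (1 - κ))) := by
    refine (le_rpow_mul_rpow_interpolate (norm_nonneg _) hη2 S3 hκ hκ1).trans ?_
    rw [Real.mul_rpow zero_le_two (by positivity), ← Real.rpow_mul hw]
    have : (2 : ℝ) ^ (1 - κ) ≤ 2 := by
      simpa using Real.rpow_le_rpow_of_exponent_le one_le_two (by linarith : 1 - κ ≤ 1)
    gcongr
  have F1 : ‖incr F u t‖ ≤ L * (η ^ κ * w ^ (a * (1 - κ))) :=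
    (h.lip u hu0 t ht0).trans (by gcongr)
  have F2 : ‖remainder S F F' u t‖ ≤ L * (w ^ a * (η ^ κ * w ^ (a * (1 - κ)))) := by
    refine (h.rem' u hu0 t ht0).trans ?_
    rw [sq]
    gcongr
  have F3 : ‖incr F' s u (incr S u t)‖ ≤ L * (w ^ a * (η ^ κ * w ^ (a * (1 - κ)))) := by
    refine ((incr F' s u).le_opNorm _).trans ?_
    rw [← mul_assoc]
    have := (h.lip' s hs0 u hu0).trans (mul_le_mul_of_nonneg_left S1 hL)
    gcongr
  have Y1 : ‖Y' s (incr S s u)‖ ≤ B * w ^ a := by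
    refine ((Y' s).le_opNorm _).trans ?_
    have := h.deriv_le s hs0
    gcongr
  -- The exponents here and in `p2` exceed the target by `a * κ` and `a - b + a * κ`; the excess
  -- goes into powers of the total increment `V T - V 0`.
  have p1 : w ^ (a + b) * w ^ (a * (1 - κ)) ≤
      (V T - V 0) ^ (a * κ) * w ^ (b + 2 * a * (1 - κ)) := by
    rw [← Real.rpow_add_of_nonneg hw (by positivity) (by positivity)]
    convert rpow_le_rpow_sub_mul_rpow hw hwD hθ (a := a + b + a * (1 - κ)) ?_ using 3
    · ring
    · linarith [mul_nonneg ha.le hκ]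
  have p2 : w ^ a * (w ^ a * w ^ (a * (1 - κ))) ≤
      (V T - V 0) ^ (a - b + a * κ) * w ^ (b + 2 * a * (1 - κ)) := by
    rw [← Real.rpow_add_of_nonneg hw (by positivity) (by positivity),
      ← Real.rpow_add_of_nonneg hw (by positivity) (by positivity)]
    convert rpow_le_rpow_sub_mul_rpow hw hwD hθ (a := a + (a + a * (1 - κ))) ?_ using 3
    · ring
    · linarith [mul_nonneg ha.le hκ]
  have p3 : w ^ b * w ^ (2 * a * (1 - κ)) = w ^ (b + 2 * a * (1 - κ)) :=
    (Real.rpow_add_of_nonneg hw hb.le (by positivity)).symm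
  rw [germ_delta, Real.norm_eq_abs]
  have i1 : |inner ℝ (remainder S Y Y' s u) (incr F u t)| ≤
      L * η ^ κ * ((V T - V 0) ^ (a * κ) * w ^ (b + 2 * a * (1 - κ))) :=
    calc _ ≤ ‖remainder S Y Y' s u‖ * ‖incr F u t‖ := abs_real_inner_le_norm _ _
      _ ≤ w ^ (a + b) * (L * (η ^ κ * w ^ (a * (1 - κ)))) := by gcongr
      _ = L * η ^ κ * (w ^ (a + b) * w ^ (a * (1 - κ))) := by ring
      _ ≤ _ := by gcongr
  have i2 : ∀ y, ‖y‖ ≤ L * (w ^ a * (η ^ κ * w ^ (a * (1 - κ)))) →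
      |inner ℝ (Y' s (incr S s u)) y| ≤
      B * L * η ^ κ * ((V T - V 0) ^ (a - b + a * κ) * w ^ (b + 2 * a * (1 - κ))) := fun y hy =>
    calc _ ≤ ‖Y' s (incr S s u)‖ * ‖y‖ := abs_real_inner_le_norm _ _
      _ ≤ B * w ^ a * (L * (w ^ a * (η ^ κ * w ^ (a * (1 - κ))))) := by gcongr
      _ = B * L * η ^ κ * (w ^ a * (w ^ a * w ^ (a * (1 - κ)))) := by ring
      _ ≤ _ := by gcongr
  have i3 : |contract (Y' u) (F' u) (secondLevel S J u t) -
          contract (Y' s) (F' s) (secondLevel S J u t)| ≤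
      2 * C * η ^ κ * w ^ (b + 2 * a * (1 - κ)) :=
    calc _ ≤ C * (V u - V s) ^ b * ‖secondLevel S J u t‖ := hcon s u hs hsu hu0.2 _
      _ ≤ C * w ^ b * (η ^ κ * (2 * w ^ (2 * a * (1 - κ)))) := by gcongr
      _ = 2 * C * η ^ κ * (w ^ b * w ^ (2 * a * (1 - κ))) := by ring
      _ = _ := by rw [p3]
  have i4 := i2 _ F2
  have i5 := i2 _ F3
  rw [abs_le] at i1 i3 i4 i5 ⊢
  constructor <;> linarith [i1.1, i1.2, i3.1, i3.2, i4.1, i4.2, i5.1, i5.2]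

end ControlledBounds

theorem exists_mul_rpow_le (M : ℝ) (hM : 0 ≤ M) {κ ε : ℝ} (hκ : 0 < κ) (hε : 0 < ε) :
    ∃ η, 0 < η ∧ M * η ^ κ ≤ ε := by
  refine ⟨(ε / (M + 1)) ^ κ⁻¹, by positivity, ?_⟩
  rw [Real.rpow_inv_rpow (by positivity) hκ.ne', mul_div_assoc', div_le_iff₀ (by positivity)]
  nlinarith

theorem exists_small_increments {E : Type*} [NormedAddCommGroup E] {X : ℝ → E}
    (hX : ContinuousOn X (Icc 0 T)) {η : ℝ} (hη : 0 < η) :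
    ∃ δ, 0 < δ ∧ ∀ s t, 0 ≤ s → s ≤ t → t ≤ T → t - s ≤ δ → ‖incr X s t‖ ≤ η := by
  obtain ⟨δ, hδ, h⟩ := Metric.uniformContinuousOn_iff.1
    (isCompact_Icc.uniformContinuousOn_of_continuous hX) η hη
  refine ⟨δ / 2, half_pos hδ, fun s t hs hst ht hd => ?_⟩
  have := h t ⟨hs.trans hst, ht⟩ s ⟨hs, hst.trans ht⟩ (by
    rw [Real.dist_eq, abs_of_nonneg (by linarith)]; linarith)
  rw [dist_eq_norm] at this
  exact this.le

namespace ControlledBounds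

/-- Interpolation may spend less than the margin `e = 2a + b - 1`, that is `2aκ < e`; the
denominator `4a + e` ensures this and `κ ≤ 1` together. -/
theorem exists_exponent (h : ControlledBounds T a b L B V S J Y Y' F F') :
    ∃ κ, 0 < κ ∧ κ ≤ 1 ∧ 1 < b + 2 * a * (1 - κ) := by
  have ha : 0 < a := h.b_pos.trans_le h.b_le
  have h1 := h.one_lt
  set e := 2 * a + b - 1 with he
  have hpos : 0 < 4 * a + e := by linarith
  refine ⟨e / (4 * a + e), div_pos (by linarith) hpos, (div_le_one hpos).2 (by linarith), ?_⟩
  have h2 : 2 * a * (e / (4 * a + e)) < e := by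
    rw [mul_div_assoc', div_lt_iff₀ hpos]
    nlinarith
  linarith

theorem exists_small_secondLevel (h : ControlledBounds T a b L B V S J Y Y' F F') {η : ℝ}
    (hη : 0 < η) : ∃ δ, 0 < δ ∧ ∀ s t, 0 ≤ s → s ≤ t → t ≤ T → t - s ≤ δ →
      ‖incr S s t‖ ≤ η ∧ ‖secondLevel S J s t‖ ≤ η := by
  obtain ⟨M, hM⟩ := isCompact_Icc.exists_bound_of_continuousOn h.continuousOn_path
  have hη' : 0 < η / (2 * (|M| + 1)) := by positivity
  obtain ⟨δ₁, h1, H1⟩ := exists_small_increments h.continuousOn_path hη'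
  obtain ⟨δ₂, h2, H2⟩ := exists_small_increments h.continuousOn_int (half_pos hη)
  refine ⟨min δ₁ δ₂, lt_min h1 h2, fun s t hs hst ht hd => ?_⟩
  have b1 := H1 s t hs hst ht (hd.trans (min_le_left _ _))
  have b2 := H2 s t hs hst ht (hd.trans (min_le_right _ _))
  have b3 : (|M| + 1) * ‖incr S s t‖ ≤ η / 2 := by
    refine (mul_le_mul_of_nonneg_left b1 (by positivity)).trans (le_of_eq ?_)
    field_simp
  have b4 : ‖S s‖ * ‖incr S s t‖ ≤ (|M| + 1) * ‖incr S s t‖ :=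
    mul_le_mul_of_nonneg_right ((hM s ⟨hs, hst.trans ht⟩).trans
      ((le_abs_self M).trans (by linarith))) (norm_nonneg _)
  have b5 : ‖incr S s t‖ ≤ (|M| + 1) * ‖incr S s t‖ :=
    le_mul_of_one_le_left (norm_nonneg _) (by linarith [abs_nonneg M])
  refine ⟨by linarith, (norm_sub_le _ _).trans ?_⟩
  rw [norm_tensor]
  change ‖incr J s t‖ + _ ≤ η
  linarith

theorem exists_mesh_compare (h : ControlledBounds T a b L B V S J Y Y' F F') {ε : ℝ}
    (hε : 0 < ε) : ∃ δ, 0 < δ ∧ ∀ t, 0 ≤ t → t ≤ T → ∀ (u v : ℕ → ℝ) (N M : ℕ),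
      MonotoneOn u (Iic N) → u 0 = 0 → u N = t → (∀ k < N, u (k + 1) - u k ≤ δ) →
      MonotoneOn v (Iic M) → v 0 = 0 → v M = t → (∀ k < M, v (k + 1) - v k ≤ δ) →
      |∑ k ∈ Finset.range N, germ (secondLevel S J) Y Y' F F' (u k) (u (k + 1)) -
        ∑ k ∈ Finset.range M, germ (secondLevel S J) Y Y' F F' (v k) (v (k + 1))| ≤ ε := by
  rcases lt_or_ge T 0 with hT | hT
  · exact ⟨1, one_pos, fun t h0 h1 => absurd (h0.trans h1) hT.not_ge⟩
  obtain ⟨κ, hκ, hκ1, hθ⟩ := h.exists_exponent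
  obtain ⟨K, hK, hδ⟩ := h.germ_delta_le hκ.le hκ1
  have hD := h.sub_nonneg le_rfl hT le_rfl
  have hC := sewingConst_nonneg hθ
  obtain ⟨η, hη, hηε⟩ := exists_mul_rpow_le
    (2 * (sewingConst (b + 2 * a * (1 - κ)) * K * (V T - V 0) ^ (b + 2 * a * (1 - κ))))
    (by positivity) hκ hε
  obtain ⟨δ, hδ0, hsmall⟩ := h.exists_small_secondLevel hη
  refine ⟨δ, hδ0, fun t _ ht u v N M hu hu0 huN huδ hv hv0 hvM hvδ => ?_⟩
  have key := sewing_compare hθ (K := K * η ^ κ) (by positivity) h.mono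
    (Ξ := germ (secondLevel S J) Y Y' F F') (δ := δ) (fun s _ => germ_self S J Y Y' F F' s)
    (fun s u t hs hsu hut ht hd => ?_) ht hu hu0 huN huδ hv hv0 hvM hvδ
  · rw [Real.norm_eq_abs] at key
    exact key.trans ((le_of_eq (by ring)).trans hηε)
  · obtain ⟨h1, h2⟩ := hsmall u t (hs.trans hsu) hut ht (by linarith)
    exact hδ η s u t hs hsu hut ht h1 h2

end ControlledBounds

end Integration

/-! ### Existence of the integral and vanishing of the compensators -/

section Limits

variable {d m : ℕ}

/-- Needed for uniqueness of the limit defining the integral; equidistant partitions have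
arbitrarily small mesh. -/
theorem meshFilter_neBot {t : ℝ} (ht : 0 ≤ t) : (meshFilter 0 t).NeBot := by
  refine comap_neBot_iff.2 fun s hs => ?_
  obtain ⟨ε, hε, hball⟩ := Metric.mem_nhds_iff.1 hs
  suffices ∃ Q : IntervalPartition 0 t, 0 ≤ Q.mesh ∧ Q.mesh < ε by
    obtain ⟨Q, h0, h1⟩ := this
    exact ⟨Q, hball (by rwa [Metric.mem_ball, Real.dist_eq, sub_zero, abs_of_nonneg h0])⟩
  have hnonneg : ∀ Q : IntervalPartition 0 t, 0 ≤ Q.mesh := fun Q =>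
    Real.iSup_nonneg fun _ => abs_nonneg _
  rcases ht.eq_or_lt with rfl | hpos
  · let Q : IntervalPartition 0 0 :=
      ⟨0, fun _ => 0, fun i hi j hj hij => by simp at hi hj; omega, rfl, rfl⟩
    refine ⟨Q, hnonneg Q, ?_⟩
    have : Q.mesh = 0 := Real.iSup_of_isEmpty (ι := Fin 0) _
    rwa [this]
  · obtain ⟨n, hn⟩ := exists_nat_gt (t / ε)
    have hn0 : (0 : ℝ) < n := (div_pos hpos hε).trans hn
    let Q : IntervalPartition 0 t :=
      ⟨n, fun k => k * (t / n), fun i _ j _ hij => by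
        have : (i : ℝ) < j := Nat.cast_lt.2 hij
        exact mul_lt_mul_of_pos_right this (div_pos hpos hn0), by simp, by field_simp⟩
    refine ⟨Q, hnonneg Q, lt_of_le_of_lt (b := t / n) (Real.iSup_le (fun k => ?_) (by positivity))
      (by rwa [div_lt_comm₀ hn0 hε])⟩
    change |((k + 1 : ℕ) : ℝ) * (t / n) - (k : ℕ) * (t / n)| ≤ t / n
    rw [Nat.cast_succ, add_mul, one_mul, add_sub_cancel_left, abs_of_nonneg (by positivity)]

theorem IntervalPartition.monotoneOn_min {T : ℝ} (P : IntervalPartition 0 T) (t : ℝ) :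
    MonotoneOn (fun k => min (P.t k) t) (Iic P.N) := fun _ hi _ hj hij =>
  min_le_min (P.monotoneOn hi hj hij) le_rfl

theorem IntervalPartition.min_mem {T : ℝ} (P : IntervalPartition 0 T) {t : ℝ} (ht : t ∈ Icc 0 T)
    {k : ℕ} (hk : k ≤ P.N) : min (P.t k) t ∈ Icc 0 T :=
  ⟨le_min (P.t_mem hk).1 ht.1, (min_le_right _ _).trans ht.2⟩

theorem IntervalPartition.min_sub_le {T : ℝ} (P : IntervalPartition 0 T) (t : ℝ) {k : ℕ}
    (hk : k < P.N) : min (P.t (k + 1)) t - min (P.t k) t ≤ P.mesh := by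
  have h1 := P.sub_le_mesh hk
  have h2 := P.t_le_succ hk
  rcases le_total (P.t k) t with h | h
  · rw [min_eq_left h]
    linarith [min_le_left (P.t (k + 1)) t]
  · rw [min_eq_right h, min_eq_right (h.trans h2)]
    linarith

variable {T a b L B : ℝ} {V : ℝ → ℝ} {S : ℝ → Vec d} {J : ℝ → Mat d}
  {Y : ℝ → Vec m} {Y' : ℝ → Vec d →L[ℝ] Vec m} {F : ℝ → Vec m} {F' : ℝ → Vec d →L[ℝ] Vec m}

namespace ControlledBounds

/-- The sums along `P n` stopped at `t` are Cauchy and define `I t`; comparison with them controls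
every other fine partition. Stopping repeats points, which is why sequences are only monotone. The
choice of `δ` before `t` gives uniformity. -/
theorem exists_integral (h : ControlledBounds T a b L B V S J Y Y' F F')
    {P : ℕ → IntervalPartition 0 T} (hmesh : Tendsto (fun n => (P n).mesh) atTop (𝓝 0)) :
    ∃ I : ℝ → ℝ, ∀ ε, 0 < ε → ∃ δ, 0 < δ ∧ ∀ t, 0 ≤ t → t ≤ T → ∀ (u : ℕ → ℝ) (N : ℕ),
      MonotoneOn u (Iic N) → u 0 = 0 → u N = t → (∀ k < N, u (k + 1) - u k ≤ δ) →
      |∑ k ∈ Finset.range N, germ (secondLevel S J) Y Y' F F' (u k) (u (k + 1)) - I t| ≤ ε := by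
  let W : ℕ → ℝ → ℝ := fun n t => ∑ k ∈ Finset.range (P n).N,
    germ (secondLevel S J) Y Y' F F' (min ((P n).t k) t) (min ((P n).t (k + 1)) t)
  have hP : ∀ δ, 0 < δ → ∃ n₀, ∀ n, n₀ ≤ n → ∀ t, ∀ k < (P n).N,
      min ((P n).t (k + 1)) t - min ((P n).t k) t ≤ δ := fun δ hδ => by
    obtain ⟨n₀, hn₀⟩ := eventually_atTop.1 (hmesh.eventually_le_const hδ)
    exact ⟨n₀, fun n hn t k hk => ((P n).min_sub_le t hk).trans (hn₀ n hn)⟩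
  have hlim : ∀ t, ∃ x, t ∈ Icc 0 T → Tendsto (fun n => W n t) atTop (𝓝 x) := fun t => by
    by_cases ht : t ∈ Icc 0 T
    swap
    · exact ⟨0, fun h' => absurd h' ht⟩
    suffices hc : CauchySeq fun n => W n t by
      obtain ⟨x, hx⟩ := cauchySeq_tendsto_of_complete hc
      exact ⟨x, fun _ => hx⟩
    refine Metric.cauchySeq_iff'.2 fun ε hε => ?_
    obtain ⟨δ, hδ, H⟩ := h.exists_mesh_compare (half_pos hε)
    obtain ⟨n₀, hn₀⟩ := hP δ hδ
    refine ⟨n₀, fun n hn => ?_⟩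
    have := H t ht.1 ht.2 (fun k => min ((P n).t k) t) (fun k => min ((P n₀).t k) t)
      (P n).N (P n₀).N ((P n).monotoneOn_min t) (by simp [(P n).left, ht.1])
      (by simp [(P n).right, ht.2]) (hn₀ n hn t) ((P n₀).monotoneOn_min t)
      (by simp [(P n₀).left, ht.1]) (by simp [(P n₀).right, ht.2]) (hn₀ n₀ le_rfl t)
    rw [Real.dist_eq]
    exact this.trans_lt (half_lt_self hε)
  choose I hI using hlim
  refine ⟨I, fun ε hε => ?_⟩
  obtain ⟨δ, hδ, H⟩ := h.exists_mesh_compare hε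
  obtain ⟨n₀, hn₀⟩ := hP δ hδ
  refine ⟨δ, hδ, fun t ht0 ht u N hu hu0 huN huδ => ?_⟩
  refine le_of_tendsto ((hI t ⟨ht0, ht⟩).const_sub _).abs ?_
  filter_upwards [eventually_ge_atTop n₀] with n hn
  exact H t ht0 ht u (fun k => min ((P n).t k) t) N (P n).N hu hu0 huN huδ
    ((P n).monotoneOn_min t) (by simp [(P n).left, ht0]) (by simp [(P n).right, ht]) (hn₀ n hn t)

/-- A Young estimate for `Y'F'` against the approximation error `Z`. Uniform smallness of `Z` is
interpolated with the bound of order `2a` on its increments, which is the only place where (RIE) on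
the whole partition, beyond its limit, is used for the Riemann sums. -/
theorem exists_contract_sum_le (h : ControlledBounds T a b L B V S J Y Y' F F') (hT : 0 ≤ T)
    {ε : ℝ} (hε : 0 < ε) : ∃ η, 0 < η ∧ ∀ P : IntervalPartition 0 T,
      (∀ k l, k ≤ l → l ≤ P.N →
        ‖tensorSum S P (P.t l) - tensorSum S P (P.t k) -
          tensor (S (P.t k)) (incr S (P.t k) (P.t l))‖ ≤ (V (P.t l) - V (P.t k)) ^ (2 * a)) →
      (∀ t ∈ Icc 0 T, ‖J t - tensorSum S P t‖ ≤ η) → ∀ t ∈ Icc 0 T,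
      |∑ k ∈ Finset.range P.N, contract (Y' (min (P.t k) t)) (F' (min (P.t k) t))
        (secondLevel S J (min (P.t k) t) (min (P.t (k + 1)) t))| ≤ ε := by
  obtain ⟨κ, hκ, hκ1, hθ⟩ := h.exists_exponent
  obtain ⟨C, hC, hcon⟩ := h.contract_sub_le
  have hD := h.sub_nonneg le_rfl hT le_rfl
  have hsC := sewingConst_nonneg hθ
  have ha : 0 < a := h.b_pos.trans_le h.b_le
  have hb := h.b_pos
  have hB := h.B_nonneg
  have hκ' : 0 ≤ 1 - κ := by linarith
  set θ := b + 2 * a * (1 - κ) with hθdef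
  obtain ⟨η₁, h1, H1⟩ := exists_mul_rpow_le (sewingConst θ * (4 * C) * (V T - V 0) ^ θ)
    (by positivity) hκ (half_pos hε)
  obtain ⟨η₂, h2, H2⟩ := exists_mul_rpow_le ((m * d * d) * (B * B)) (by positivity) one_pos
    (half_pos hε)
  rw [Real.rpow_one] at H2
  refine ⟨min η₁ η₂ / 2, half_pos (lt_min h1 h2), fun P hP hJ t ht => ?_⟩
  have hvm := P.monotoneOn_min t
  have hmem : ∀ k ≤ P.N, min (P.t k) t ∈ Icc 0 T := fun k hk => P.min_mem ht hk
  have hdich : ∀ k l, k ≤ l → l ≤ P.N →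
      -- Either the left point is a genuine partition point, as the (RIE) bound requires, or `t` has
      -- been passed and the interval is degenerate.
      min (P.t k) t = P.t k ∨ min (P.t l) t = min (P.t k) t := fun k l hkl hl => by
    rcases le_total (P.t k) t with hk | hk
    · exact Or.inl (min_eq_left hk)
    · right
      rw [min_eq_right hk, min_eq_right (hk.trans
        (P.monotoneOn (mem_Iic.2 (hkl.trans hl)) (mem_Iic.2 hl) hkl))]
  set v : ℕ → ℝ := fun k => min (P.t k) t with hv
  set Z : ℝ → Mat d := fun t => J t - tensorSum S P t with hZ
  have hstep : ∀ k < P.N, secondLevel S J (v k) (v (k + 1)) = Z (v (k + 1)) - Z (v k) := by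
    intro k hk
    rcases hdich k (k + 1) (Nat.le_succ k) hk with e | e
    · have : tensorSum S P (v (k + 1)) - tensorSum S P (v k) =
          tensor (S (P.t k)) (incr S (v k) (v (k + 1))) :=
        tensorSum_sub S P hk e.ge (hvm (mem_Iic.2 hk.le) (mem_Iic.2 hk) (Nat.le_succ k))
          (min_le_left _ _)
      rw [secondLevel, show S (v k) = S (P.t k) from congrArg S e, ← this]
      simp only [hZ]
      abel
    · rw [show v (k + 1) = v k from e]
      simp [secondLevel, incr, tensor_zero_right]
  have hZ1 : ∀ k l, k ≤ P.N → l ≤ P.N → ‖Z (v l) - Z (v k)‖ ≤ min η₁ η₂ := fun k l hk hl =>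
    (norm_sub_le _ _).trans (by linarith [hJ _ (hmem k hk), hJ _ (hmem l hl)])
  -- The constant 4 is 2 from the second level plus 2 from the discrete integral.
  have hZ2 : ∀ k l, k ≤ l → l ≤ P.N →
      ‖Z (v l) - Z (v k)‖ ≤ 4 * (V (v l) - V (v k)) ^ (2 * a) := by
    intro k l hkl hl
    have hk0 := hmem k (hkl.trans hl)
    have hl0 := hmem l hl
    have hvkl : v k ≤ v l := hvm (mem_Iic.2 (hkl.trans hl)) (mem_Iic.2 hl) hkl
    rcases hdich k l hkl hl with e | e
    · have b1 := h.area (v k) (v l) hk0.1 hvkl hl0.2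
      have b2 := norm_tensorSum_sub_le h.mono ha h.path P hP (hkl.trans hl)
        (e.ge.trans hvkl) hl0.2
      rw [← show v k = P.t k from e] at b2
      have e2 : Z (v l) - Z (v k) = secondLevel S J (v k) (v l) -
          (tensorSum S P (v l) - tensorSum S P (v k) - tensor (S (v k)) (incr S (v k) (v l))) := by
        simp only [hZ, secondLevel]
        abel
      rw [e2]
      exact (norm_sub_le _ _).trans (by linarith)
    · rw [show v l = v k from e]
      simp [Real.zero_rpow, ha.ne']
  have hη : 0 < min η₁ η₂ := lt_min h1 h2
  have key := discrete_sewing hθ (K := 4 * C * (min η₁ η₂) ^ κ) (by positivity)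
    (fun k l => contract (Y' (v k)) (F' (v k)) (Z (v l) - Z (v k))) (fun k => V (v k)) (N := P.N)
    (fun i hi j hj hij => h.mono (hmem i hi) (hmem j hj) (hvm hi hj hij))
    (fun i _ => by simp [contract_zero_right]) (fun i j k hij hjk hk => ?_)
    (Nat.zero_le P.N) le_rfl
  -- Sewing compares the sum with this single term over the whole range, which is small because `Z`
  -- is.
  · have b1 : |contract (Y' (v 0)) (F' (v 0)) (Z (v P.N) - Z (v 0))| ≤ ε / 2 := by
      refine (abs_contract_le _ _ _).trans (le_trans ?_ H2)
      rw [mul_assoc _ (B * B)]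
      have c1 := h.deriv_le _ (hmem 0 (Nat.zero_le _))
      have c2 := h.deriv_le' _ (hmem 0 (Nat.zero_le _))
      have c3 := (hZ1 0 P.N (Nat.zero_le _) le_rfl).trans (min_le_right _ _)
      gcongr
    have b2 : sewingConst θ * (4 * C * (min η₁ η₂) ^ κ) * (V (v P.N) - V (v 0)) ^ θ ≤ ε / 2 := by
      refine le_trans ?_ H1
      have c1 := hmem 0 (Nat.zero_le _)
      have c2 := hmem P.N le_rfl
      have c3 : v 0 ≤ v P.N := hvm (mem_Iic.2 (Nat.zero_le _)) (mem_Iic.2 le_rfl) (Nat.zero_le _)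
      have c4 := h.sub_nonneg c1.1 c3 c2.2
      have c5 := h.sub_le c1.1 c3 c2.2
      calc _ ≤ sewingConst θ * (4 * C * η₁ ^ κ) * (V T - V 0) ^ θ := by
            gcongr
            exact min_le_left _ _
        _ = _ := by ring
    rw [← Finset.range_eq_Ico, Real.norm_eq_abs] at key
    rw [Finset.sum_congr rfl fun k hk => by rw [hstep k (Finset.mem_range.1 hk)]]
    rw [abs_le] at key b1 ⊢
    constructor <;> linarith [key.1, key.2, b1.1, b1.2]
  · have hi0 := hmem i (hij.trans (hjk.trans hk))
    have hj0 := hmem j (hjk.trans hk)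
    have hk0 := hmem k hk
    have hvij : v i ≤ v j :=
      hvm (mem_Iic.2 (hij.trans (hjk.trans hk))) (mem_Iic.2 (hjk.trans hk)) hij
    have hvjk : v j ≤ v k := hvm (mem_Iic.2 (hjk.trans hk)) (mem_Iic.2 hk) hjk
    have w1 := h.sub_nonneg hi0.1 hvij hj0.2
    have w2 := h.sub_nonneg hj0.1 hvjk hk0.2
    have e : contract (Y' (v i)) (F' (v i)) (Z (v k) - Z (v i)) -
        contract (Y' (v i)) (F' (v i)) (Z (v j) - Z (v i)) -
        contract (Y' (v j)) (F' (v j)) (Z (v k) - Z (v j)) =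
        -(contract (Y' (v j)) (F' (v j)) (Z (v k) - Z (v j)) -
          contract (Y' (v i)) (F' (v i)) (Z (v k) - Z (v j))) := by
      rw [← sub_add_sub_cancel (Z (v k)) (Z (v j)) (Z (v i)), contract_add_right]
      ring
    rw [e, norm_neg, Real.norm_eq_abs]
    set w := V (v k) - V (v i) with hw
    have w0 : 0 ≤ w := by linarith
    have b1 : V (v j) - V (v i) ≤ w := by linarith
    have b2 : V (v k) - V (v j) ≤ w := by linarith
    have b3 : ‖Z (v k) - Z (v j)‖ ≤ (min η₁ η₂) ^ κ * (4 * w ^ (2 * a * (1 - κ))) := by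
      refine (le_rpow_mul_rpow_interpolate (norm_nonneg _) (hZ1 j k (hjk.trans hk) hk)
        ((hZ2 j k hjk hk).trans (show _ ≤ 4 * w ^ (2 * a) by gcongr)) hκ.le hκ1).trans ?_
      rw [Real.mul_rpow (by norm_num) (by positivity), ← Real.rpow_mul w0]
      have : (4 : ℝ) ^ (1 - κ) ≤ 4 := by
        simpa using Real.rpow_le_rpow_of_exponent_le (by norm_num : (1 : ℝ) ≤ 4)
          (by linarith : 1 - κ ≤ 1)
      gcongr
    calc _ ≤ C * (V (v j) - V (v i)) ^ b * ‖Z (v k) - Z (v j)‖ := hcon _ _ hi0.1 hvij hj0.2 _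
      _ ≤ C * w ^ b * ((min η₁ η₂) ^ κ * (4 * w ^ (2 * a * (1 - κ)))) := by gcongr
      _ = 4 * C * (min η₁ η₂) ^ κ * (w ^ b * w ^ (2 * a * (1 - κ))) := by ring
      _ = _ := by rw [← Real.rpow_add_of_nonneg w0 hb.le (by positivity)]

end ControlledBounds

end Limits

/-! ### Riemann sums, composition with `f`, and the conclusion -/

section Main

variable {d m : ℕ} {T a b L B p q : ℝ} {V : ℝ → ℝ} {S : ℝ → Vec d} {J : ℝ → Mat d}
  {Y : ℝ → Vec m} {Y' : ℝ → Vec d →L[ℝ] Vec m} {F : ℝ → Vec m} {F' : ℝ → Vec d →L[ℝ] Vec m}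

/-- Evaluating `Y` at the stopped or the unstopped left point makes no difference: where the two
differ, the increment of `F` vanishes. -/
theorem sum_germ_eq_riemannSum_add (P : IntervalPartition 0 T) (t : ℝ) :
    ∑ k ∈ Finset.range P.N,
        germ (secondLevel S J) Y Y' F F' (min (P.t k) t) (min (P.t (k + 1)) t) =
      ∑ k ∈ Finset.range P.N, inner ℝ (Y (P.t k)) (F (min (P.t (k + 1)) t) - F (min (P.t k) t)) +
      ∑ k ∈ Finset.range P.N, contract (Y' (min (P.t k) t)) (F' (min (P.t k) t))
        (secondLevel S J (min (P.t k) t) (min (P.t (k + 1)) t)) := by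
  rw [← Finset.sum_add_distrib]
  refine Finset.sum_congr rfl fun k hk => ?_
  have hk := P.t_le_succ (Finset.mem_range.1 hk)
  rw [germ]
  congr 1
  rcases le_total (P.t k) t with h | h
  · rw [min_eq_left h, incr]
  · rw [min_eq_right h, min_eq_right (h.trans hk), incr, sub_self, inner_zero_right,
      inner_zero_right]

/-- Since `γ ≤ 1`, an exponent above 2 forces `k ≥ 2`. -/
theorem IsCHolder.contDiffOn_two {β : ℝ} {f : Vec d → Vec m} {A : Set (Vec d)}
    (hf : IsCHolder β f A) (hβ : 2 < β) : ContDiffOn ℝ 2 f A := by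
  obtain ⟨k, γ, -, hγ1, rfl, hk, -⟩ := hf
  have h1 : (γ : ℝ) ≤ 1 := hγ1
  have h2 : (1 : ℝ) < k := by linarith
  have h3 : 2 ≤ k := by exact_mod_cast h2
  exact hk.of_le (by exact_mod_cast h3)

/-- The derivative has order `1/p ≥ 1/q` and the remainder order `2/p ≥ 1/p + 1/q`; surplus powers
are absorbed by `V T - V 0`. -/
theorem isControlledPath_comp (hp : 0 < p) (hpq : p ≤ q) (hT : 0 ≤ T) (hL : 0 ≤ L)
    (hV : MonotoneOn V (Icc 0 T))
    (hSV : ∀ s t, 0 ≤ s → s ≤ t → t ≤ T → ‖incr S s t‖ ≤ (V t - V s) ^ (1 / p))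
    (hF : ContinuousOn F (Icc 0 T)) (hF' : ContinuousOn F' (Icc 0 T))
    (lip' : ∀ s ∈ Icc 0 T, ∀ t ∈ Icc 0 T, ‖incr F' s t‖ ≤ L * ‖incr S s t‖)
    (rem' : ∀ s ∈ Icc 0 T, ∀ t ∈ Icc 0 T, ‖remainder S F F' s t‖ ≤ L * ‖incr S s t‖ ^ 2) :
    IsControlledPath T p q S F F' := by
  have hq : 0 < q := hp.trans_le hpq
  have hle : 1 / q ≤ 1 / p := one_div_le_one_div_of_le hp hpq
  have hD : 0 ≤ V T - V 0 := sub_nonneg.2 (hV ⟨le_rfl, hT⟩ ⟨hT, le_rfl⟩ hT)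
  have hw : ∀ s t, 0 ≤ s → s ≤ t → t ≤ T → 0 ≤ V t - V s ∧ V t - V s ≤ V T - V 0 := by
    intro s t hs hst ht
    have h1 := hV ⟨hs, hst.trans ht⟩ ⟨hs.trans hst, ht⟩ hst
    have h2 := hV ⟨hs.trans hst, ht⟩ ⟨hT, le_rfl⟩ ht
    have h3 := hV ⟨le_rfl, hT⟩ ⟨hs, hst.trans ht⟩ hs
    constructor <;> linarith
  refine ⟨hF, hF', pVar_lt_top_of_control hq hV
    (C := L * (V T - V 0) ^ (1 / p - 1 / q)) (by positivity) fun s t hs hst ht => ?_,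
    pVar_lt_top_of_control (by positivity) hV
    (C := L * (V T - V 0) ^ (1 / p + 1 / p - (1 / p + 1 / q))) (by positivity)
    fun s t hs hst ht => ?_⟩
  all_goals
    obtain ⟨w0, wD⟩ := hw s t hs hst ht
    have hs0 : s ∈ Icc 0 T := ⟨hs, hst.trans ht⟩
    have ht0 : t ∈ Icc 0 T := ⟨hs.trans hst, ht⟩
    have h1 := hSV s t hs hst ht
  · rw [mul_assoc]
    refine (lip' s hs0 t ht0).trans (mul_le_mul_of_nonneg_left (h1.trans ?_) hL)
    exact rpow_le_rpow_sub_mul_rpow w0 wD (by positivity) hle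
  · rw [mul_assoc, one_div_one_div]
    refine (rem' s hs0 t ht0).trans (mul_le_mul_of_nonneg_left ?_ hL)
    refine le_trans ?_ (rpow_le_rpow_sub_mul_rpow w0 wD (by positivity) (by linarith))
    rw [sq, Real.rpow_add_of_nonneg w0 (by positivity) (by positivity)]
    gcongr

namespace ControlledBounds

theorem tendsto_integral (h : ControlledBounds T a b L B V S J Y Y' F F') (hT : 0 ≤ T)
    {P : ℕ → IntervalPartition 0 T} (hmesh : Tendsto (fun n => (P n).mesh) atTop (𝓝 0))
    (hP : ∀ n k l, k ≤ l → l ≤ (P n).N →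
        ‖tensorSum S (P n) ((P n).t l) - tensorSum S (P n) ((P n).t k) -
          tensor (S ((P n).t k)) (incr S ((P n).t k) ((P n).t l))‖ ≤
            (V ((P n).t l) - V ((P n).t k)) ^ (2 * a))
    (hJ : TendstoUniformlyOn (fun n t => tensorSum S (P n) t) J atTop (Icc 0 T)) :
    ∃ I : ℝ → ℝ,
      (∀ t ∈ Icc 0 T, Tendsto (fun Q : IntervalPartition 0 t =>
        compensatedSum (secondLevel S J) Y Y' F F' Q) (meshFilter 0 t) (𝓝 (I t))) ∧
      TendstoUniformlyOn (fun n t => ∑ k ∈ Finset.range (P n).N, inner ℝ (Y ((P n).t k))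
        (F (min ((P n).t (k + 1)) t) - F (min ((P n).t k) t))) I atTop (Icc 0 T) := by
  obtain ⟨I, hI⟩ := h.exists_integral hmesh
  refine ⟨I, fun t ht => Metric.tendsto_nhds.2 fun ε hε => ?_,
    Metric.tendstoUniformlyOn_iff.2 fun ε hε => ?_⟩
  · obtain ⟨δ, hδ, H⟩ := hI (ε / 2) (half_pos hε)
    have : ∀ᶠ Q : IntervalPartition 0 t in meshFilter 0 t, Q.mesh ≤ δ :=
      tendsto_comap.eventually_le_const hδ
    filter_upwards [this] with Q hQ
    rw [Real.dist_eq]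
    exact (H t ht.1 ht.2 Q.t Q.N Q.monotoneOn Q.left Q.right fun k hk =>
      (Q.sub_le_mesh hk).trans hQ).trans_lt (half_lt_self hε)
  · have hε3 : 0 < ε / 3 := by positivity
    obtain ⟨δ, hδ, H⟩ := hI (ε / 3) hε3
    obtain ⟨η, hη, H'⟩ := h.exists_contract_sum_le hT hε3
    filter_upwards [hmesh.eventually_le_const hδ, Metric.tendstoUniformlyOn_iff.1 hJ η hη]
      with n hn hn' t ht
    have b1 := H t ht.1 ht.2 (fun k => min ((P n).t k) t) (P n).N ((P n).monotoneOn_min t)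
      (by simp [(P n).left, ht.1]) (by simp [(P n).right, ht.2]) fun k hk =>
      ((P n).min_sub_le t hk).trans hn
    have b2 := H' (P n) (hP n) (fun t ht => by rw [← dist_eq_norm]; exact (hn' t ht).le) t ht
    rw [sum_germ_eq_riemannSum_add] at b1
    rw [dist_comm, Real.dist_eq]
    rw [abs_le] at b1 b2
    rw [abs_lt]
    constructor <;> linarith [b1.1, b1.2, b2.1, b2.2]

end ControlledBounds

end Main

end RoughRIE

theorem mainTheorem6 {d m : ℕ} {T p q ε : ℝ} (hT : 0 < T)
    (P : ℕ → RoughRIE.IntervalPartition 0 T) (S : ℝ → RoughRIE.Vec d)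
    (hS : RoughRIE.SatisfiesRIE T p P S)
    (hpq : p ≤ q) (hq : 1 < 2 / p + 1 / q) (hε : 0 < ε)
    (A : Set (RoughRIE.Vec d)) (hA : IsOpen A) (hSA : ∀ t ∈ Icc 0 T, S t ∈ A)
    (f : RoughRIE.Vec d → RoughRIE.Vec m) (hf : RoughRIE.IsCHolder (p + ε) f A) :
    RoughRIE.IsControlledPath T p q S (fun t => f (S t)) (fun t => fderiv ℝ f (S t)) ∧
    ∀ (Y : ℝ → RoughRIE.Vec m) (Y' : ℝ → RoughRIE.Vec d →L[ℝ] RoughRIE.Vec m),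
      RoughRIE.IsControlledPath T p q S Y Y' →
      (∀ t ∈ Icc 0 T,
        Tendsto
          (fun Q : RoughRIE.IntervalPartition 0 t =>
            RoughRIE.compensatedSum (RoughRIE.area P S) Y Y'
              (fun u => f (S u)) (fun u => fderiv ℝ f (S u)) Q)
          (RoughRIE.meshFilter 0 t)
          (𝓝 (RoughRIE.controlledIntegral (RoughRIE.area P S) Y Y'
            (fun u => f (S u)) (fun u => fderiv ℝ f (S u)) t))) ∧
      TendstoUniformlyOn
        (fun n t => ∑ k ∈ Finset.range (P n).N,
          inner ℝ (Y ((P n).t k))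
            (f (S (min ((P n).t (k + 1)) t)) - f (S (min ((P n).t k) t))))
        (RoughRIE.controlledIntegral (RoughRIE.area P S) Y Y'
          (fun u => f (S u)) (fun u => fderiv ℝ f (S u)))
        atTop (Icc 0 T) := by
  have hp : 0 < p := by linarith [hS.two_lt]
  have hq0 : 0 < q := hp.trans_le hpq
  have hf2 := hf.contDiffOn_two (by linarith [hS.two_lt])
  have hSc := hS.continuousOn
  obtain ⟨L, hL, hTay⟩ := RoughRIE.exists_taylor_bounds hA hf2
    (isCompact_Icc.image_of_continuousOn hSc)
    (image_subset_iff.2 hSA)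
  have hTay' := fun s hs t ht => hTay (S s) (mem_image_of_mem S hs) (S t) (mem_image_of_mem S ht)
  have hFc : ContinuousOn (fun t => f (S t)) (Icc 0 T) := hf2.continuousOn.comp hSc hSA
  have hFc' : ContinuousOn (fun t => fderiv ℝ f (S t)) (Icc 0 T) :=
    (hf2.continuousOn_fderiv_of_isOpen hA (by norm_num)).comp hSc hSA
  obtain ⟨V₀, hV₀, hSV, hPV⟩ := hS.exists_control
  refine ⟨RoughRIE.isControlledPath_comp hp hpq hT.le hL hV₀ hSV hFc hFc'
    (fun s hs t ht => (hTay' s hs t ht).2.1) (fun s hs t ht => (hTay' s hs t ht).2.2),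
    fun Y Y' hY => ?_⟩
  obtain ⟨V₁, hV₁, hYV₁⟩ := RoughRIE.exists_control_of_pVar_lt_top hq0
    (fun s => by simp [RoughRIE.incr]) hY.deriv_var
  obtain ⟨V₂, hV₂, hYV₂⟩ := RoughRIE.exists_control_of_pVar_lt_top (by positivity)
    (fun s => by simp [RoughRIE.remainder, RoughRIE.incr]) hY.remainder_var
  obtain ⟨B₁, hB₁⟩ := isCompact_Icc.exists_bound_of_continuousOn hY.continuousOn_deriv
  obtain ⟨B₂, hB₂⟩ := isCompact_Icc.exists_bound_of_continuousOn hFc'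
  -- The limit supplied by (RIE) agrees on `[0, T]` with the pointwise `limUnder`, so uniform
  -- convergence transfers to it.
  have hJ : TendstoUniformlyOn (fun n t => RoughRIE.tensorSum S (P n) t)
      (RoughRIE.limitIntegral P S) atTop (Icc 0 T) := by
    obtain ⟨J, hJ⟩ := hS.converges
    exact hJ.congr_right fun t ht => ((hJ.tendsto_at ht).limUnder_eq).symm
  have h2p : 2 / p = 2 * (1 / p) := by ring
  simp only [h2p] at hPV
  have hinc : ∀ s t, 0 ≤ s → s ≤ t → t ≤ T →
      0 ≤ V₀ t - V₀ s ∧ 0 ≤ V₁ t - V₁ s ∧ 0 ≤ V₂ t - V₂ s := fun s t hs hst ht =>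
    ⟨sub_nonneg.2 (hV₀ ⟨hs, hst.trans ht⟩ ⟨hs.trans hst, ht⟩ hst),
      sub_nonneg.2 (hV₁ ⟨hs, hst.trans ht⟩ ⟨hs.trans hst, ht⟩ hst),
      sub_nonneg.2 (hV₂ ⟨hs, hst.trans ht⟩ ⟨hs.trans hst, ht⟩ hst)⟩
  have hup : ∀ s t, 0 ≤ s → s ≤ t → t ≤ T → ∀ e : ℝ, 0 ≤ e →
      (V₀ t - V₀ s) ^ e ≤ ((V₀ t + V₁ t + V₂ t) - (V₀ s + V₁ s + V₂ s)) ^ e ∧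
      (V₁ t - V₁ s) ^ e ≤ ((V₀ t + V₁ t + V₂ t) - (V₀ s + V₁ s + V₂ s)) ^ e ∧
      (V₂ t - V₂ s) ^ e ≤ ((V₀ t + V₁ t + V₂ t) - (V₀ s + V₁ s + V₂ s)) ^ e := by
    intro s t hs hst ht e he
    obtain ⟨h0, h1, h2⟩ := hinc s t hs hst ht
    exact ⟨Real.rpow_le_rpow h0 (by linarith) he, Real.rpow_le_rpow h1 (by linarith) he,
      Real.rpow_le_rpow h2 (by linarith) he⟩
  have hp' : 0 < 1 / p := by positivity
  have hq' : 0 < 1 / q := by positivity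
  -- Adding the three monotone functions gives one control that dominates the increments of each.
  have hbounds : RoughRIE.ControlledBounds T (1 / p) (1 / q) L (max 0 (max B₁ B₂))
      (fun t => V₀ t + V₁ t + V₂ t) S (RoughRIE.limitIntegral P S) Y Y' (fun t => f (S t))
      (fun t => fderiv ℝ f (S t)) :=
    { b_pos := hq'
      b_le := one_div_le_one_div_of_le hp hpq
      one_lt := by rwa [← h2p]
      L_nonneg := hL
      B_nonneg := le_max_left _ _
      mono := (hV₀.add hV₁).add hV₂
      continuousOn_path := hSc
      continuousOn_int := hJ.continuousOn
        (Frequently.of_forall fun n => RoughRIE.continuousOn_tensorSum hSc (P n))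
      path := fun s t hs hst ht =>
        (hSV s t hs hst ht).trans (hup s t hs hst ht _ hp'.le).1
      area := fun s t hs hst ht =>
        (RoughRIE.norm_area_le hV₀ hp' hSc hSV hS.mesh_tendsto hPV hJ hs hst ht).trans
          (mul_le_mul_of_nonneg_left (hup s t hs hst ht _ (by positivity)).1 zero_le_two)
      deriv := fun s t hs hst ht =>
        (hYV₁ s t hs hst ht).trans (hup s t hs hst ht _ hq'.le).2.1
      rem := fun s t hs hst ht => by
        have := hYV₂ s t hs hst ht
        rw [one_div_one_div] at this
        exact this.trans (hup s t hs hst ht _ (by positivity)).2.2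
      deriv_le := fun s hs => (hB₁ s hs).trans ((le_max_left _ _).trans (le_max_right _ _))
      deriv_le' := fun s hs => (hB₂ s hs).trans ((le_max_right _ _).trans (le_max_right _ _))
      lip := fun s hs t ht => (hTay' s hs t ht).1
      lip' := fun s hs t ht => (hTay' s hs t ht).2.1
      rem' := fun s hs t ht => (hTay' s hs t ht).2.2 }
  obtain ⟨I, hI, hI'⟩ := hbounds.tendsto_integral hT.le hS.mesh_tendsto
    (fun n k l hkl hl => (hPV n k l hkl hl).trans
      (hup _ _ ((P n).t_mem (hkl.trans hl)).1
        ((P n).monotoneOn (mem_Iic.2 (hkl.trans hl)) (mem_Iic.2 hl) hkl)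
        ((P n).t_mem hl).2 _ (by positivity)).1) hJ
  refine ⟨fun t ht => tendsto_nhds_limUnder ⟨I t, hI t ht⟩, hI'.congr_right fun t ht => ?_⟩
  have := RoughRIE.meshFilter_neBot ht.1
  exact (hI t ht).limUnder_eq.symm
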